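/- **Definitions.** Let $(X,d)$ be a metric space. A (discrete) curve with $n\ge 1$ vertices is a sequence $P=\langle p_1,\dots,p_n\rangle$ in $X$; its edges have the lengths $d(p_k,p_{k+1})$. It is *$t$-straight* if $\sum_{k=i}^{j-1}d(p_k,p_{k+1})\le t\, d(p_i,p_j)$ for all $i\le j$. A *coupling path* is a sequence in $[n]\times[n]$ from $(1,1)$ to $(n,n)$ in which $(i,j)$ is always followed by $(i+1,j)$, $(i,j+1)$ or $(i+1,j+1)$. The discrete Fréchet distance of $P$ and $Q$ is $\min_{\mathcal C}\max_{(i,j)\in\mathcal C}d(p_i,q_j)$ over all coupling paths $\mathcal C$. The $\delta$-free space matrix $M_\delta$ has the entry $M_\delta[i,j]=0$ if $d(p_i,q_j)\le\delta$ and $M_\delta[i,j]=1$ otherwise (column $i$ belongs to $p_i$, row $j$ to $q_j$). $P$ and $Q$ are *$(\varepsilon,\delta)$-far* if every coupling path visits more than $\varepsilon n$ one-entries of $M_\delta$. A *query* asks for one column or one row of the $\rho$-free space matrix and is answered by the set of indices of its zero-entries; here $\rho\in[\delta,(1+\varepsilon')\delta]$ is a radius that the tester fixes in advance. A *$(1+\varepsilon')$-approximate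 Fréchet-tester* (for a class of pairs of curves and given $\delta,\varepsilon$) is a randomized adaptive algorithm that learns about $P$ and $Q$ only through such queries and that, for every pair $P,Q$ in the class, always returns "yes" if the discrete Fréchet distance of $P$ and $Q$ is at most $\delta$, and returns "no" with probability at least $\frac45$ if $P$ and $Q$ are $(\varepsilon,(1+\varepsilon')\delta)$-far. **Theorem.** For every $\gamma\ge1$ there is a constant $K>0$, depending only on $\gamma$, such that the following holds for all $n\ge1$, $\alpha>0$, $\delta>0$, $0<\varepsilon<2$ and $\varepsilon'>0$ (no relation between $\alpha$ and $\delta$ is required). Put $e=\min(1,\varepsilon')$, and consider pairs $P,Q$ of curves with $n$ vertices each, in arbitrary metric spaces, all of whose edge lengths lie in $[\alpha/\gamma,\alpha]$. 1. ($t$ known.) For every $t\ge1$ there is a $(1+\varepsilon')$-approximate Fréchet-tester for all such pairs of $t$-straight curves that performs at most $$K\cdot\frac{t}{\varepsilon e}\,\log\Bigl(2+\frac{t}{\varepsilon e}\Bigr)$$ queries. 2. ($t$ unknown.) There is one algorithm, not depending on $t$, that for every $t\ge 1$ is a $(1+\varepsilon')$-approximate Fréchet-tester for all such pairs of $t$-straight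 curves and performs on them at most $$K\cdot\Bigl(\bigl(\tfrac{t}{e}\bigr)^3+\bigl(\tfrac{t}{e}\bigr)^2\log n\Bigr)\cdot\frac{\log\bigl(2+\log(2+\frac{t}{e})\bigr)}{\varepsilon}$$ queries. The query bounds hold for every outcome of the random choices. -/

import Mathlib

/-! Discrete curves with `n` vertices are functions `Fin n → X`. The indices are 0-based, so the
lattice `[n] × [n]` is `Fin n × Fin n`, with corners `(0, 0)` and `(n - 1, n - 1)`. -/

noncomputable section

namespace FrechetTesting

section Curves

variable {X : Type*} [MetricSpace X] {n : ℕ}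

/-- The length `d (p k) (p (k + 1))` of the `k`-th edge (it is only used for `k + 1 < n`). -/
def edgeLength (P : Fin n → X) (k : ℕ) : ℝ :=
  if h : k + 1 < n then dist (P ⟨k, Nat.lt_of_succ_lt h⟩) (P ⟨k + 1, h⟩) else 0

/-- The length of the subcurve between the vertices `i` and `j`, for `i ≤ j`. -/
def subcurveLength (P : Fin n → X) (i j : Fin n) : ℝ :=
  ∑ k ∈ Finset.Ico (i : ℕ) (j : ℕ), edgeLength P k

/-- `P` is `κ`-straight. -/
def IsStraight (κ : ℝ) (P : Fin n → X) : Prop :=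
  ∀ i j : Fin n, i ≤ j → subcurveLength P i j ≤ κ * dist (P i) (P j)

/-- All edges of `P` have length in `[a, b]`. -/
def EdgeLengthsIn (a b : ℝ) (P : Fin n → X) : Prop :=
  ∀ k : ℕ, k + 1 < n → edgeLength P k ∈ Set.Icc a b

/-- A single step of a coupling. -/
def CouplingStep (p q : Fin n × Fin n) : Prop :=
  ((q.1 : ℕ) = p.1 + 1 ∧ (q.2 : ℕ) = p.2) ∨
  ((q.1 : ℕ) = p.1 ∧ (q.2 : ℕ) = p.2 + 1) ∨
  ((q.1 : ℕ) = p.1 + 1 ∧ (q.2 : ℕ) = p.2 + 1)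

/-- A coupling (or coupling path): a sequence of lattice points from the first corner to the last
one in which consecutive elements form coupling steps. -/
def IsCoupling (C : List (Fin n × Fin n)) : Prop :=
  C ≠ [] ∧
  (∀ p ∈ C.head?, (p.1 : ℕ) = 0 ∧ (p.2 : ℕ) = 0) ∧
  (∀ p ∈ C.getLast?, (p.1 : ℕ) + 1 = n ∧ (p.2 : ℕ) + 1 = n) ∧
  C.IsChain CouplingStep

/-- The discrete Fréchet distance: the minimum over all couplings of the maximal distance of a
coupled pair. For `n ≥ 1` both extrema are attained. -/
def discreteFrechetDist (P Q : Fin n → X) : ℝ :=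
  ⨅ C : {C : List (Fin n × Fin n) // IsCoupling C},
    ⨆ p : {p : Fin n × Fin n // p ∈ C.1}, dist (P p.1.1) (Q p.1.2)

open Classical in
/-- The `δ`-free space matrix: the first index is the column (vertex of `P`), the second index is
the row (vertex of `Q`); the entry is `0` if the two vertices have distance at most `δ`, and `1`
otherwise. -/
def freeSpaceMatrix (δ : ℝ) (P Q : Fin n → X) (i j : Fin n) : ℕ :=
  if dist (P i) (Q j) ≤ δ then 0 else 1

/-- The cost of a path in a matrix: the number of one-entries that it visits. -/
def pathCost (M : Fin n → Fin n → ℕ) (C : List (Fin n × Fin n)) : ℕ :=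
  (C.map fun p => M p.1 p.2).sum

/-- `P` and `Q` are `(ε, δ)`-far: no coupling path has cost at most `ε * n` in the `δ`-free space
matrix. -/
def IsFar (ε δ : ℝ) (P Q : Fin n → X) : Prop :=
  ¬ ∃ C : List (Fin n × Fin n),
    IsCoupling C ∧ (pathCost (freeSpaceMatrix δ P Q) C : ℝ) ≤ ε * n

end Curves

/-- Randomized adaptive query algorithms on an `n × n` matrix, as decision trees. An algorithm
returns an answer (`true` is "yes", `false` is "no"), or queries a column or a row and continues
depending on the reply, which is the set of indices of the zero-entries of this column or row, or
draws a uniformly random element of `{0, …, k}` and continues depending on it. -/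
inductive QueryAlgorithm (n : ℕ) : Type
  | answer (b : Bool) : QueryAlgorithm n
  | queryColumn (i : Fin n) (next : Finset (Fin n) → QueryAlgorithm n) : QueryAlgorithm n
  | queryRow (j : Fin n) (next : Finset (Fin n) → QueryAlgorithm n) : QueryAlgorithm n
  | draw (k : ℕ) (next : Fin (k + 1) → QueryAlgorithm n) : QueryAlgorithm n

namespace QueryAlgorithm

variable {n : ℕ}

/-- The reply to the query of column `i`. -/
def columnZeros (M : Fin n → Fin n → ℕ) (i : Fin n) : Finset (Fin n) :=
  Finset.univ.filter fun j => M i j = 0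

/-- The reply to the query of row `j`. -/
def rowZeros (M : Fin n → Fin n → ℕ) (j : Fin n) : Finset (Fin n) :=
  Finset.univ.filter fun i => M i j = 0

/-- The distribution of the answer of the algorithm on the matrix `M`. -/
def output (M : Fin n → Fin n → ℕ) : QueryAlgorithm n → PMF Bool
  | answer b => PMF.pure b
  | queryColumn i next => output M (next (columnZeros M i))
  | queryRow j next => output M (next (rowZeros M j))
  | draw k next => (PMF.uniformOfFintype (Fin (k + 1))).bind fun r => output M (next r)

/-- The largest number of queries, over all outcomes of the random choices, that the algorithm
performs on the matrix `M`. -/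
def queryCount (M : Fin n → Fin n → ℕ) : QueryAlgorithm n → ℕ
  | answer _ => 0
  | queryColumn i next => queryCount M (next (columnZeros M i)) + 1
  | queryRow j next => queryCount M (next (rowZeros M j)) + 1
  | draw _ next => Finset.univ.sup fun r => queryCount M (next r)

end QueryAlgorithm

/-- On the input `P`, `Q` the algorithm `A`, run with query access to the `ρ`-free space matrix,
meets the requirements on a `μ`-approximate Fréchet-tester (with one-sided error) for the
parameters `ε` and `δ`. -/
def TestsCorrectly {X : Type*} [MetricSpace X] {n : ℕ} (μ ε δ ρ : ℝ) (A : QueryAlgorithm n)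
    (P Q : Fin n → X) : Prop :=
  (discreteFrechetDist P Q ≤ δ → A.output (freeSpaceMatrix ρ P Q) true = 1) ∧
  (IsFar ε (μ * δ) P Q → 4 / 5 ≤ A.output (freeSpaceMatrix ρ P Q) false)

/-- The query bound for known `t`, where `e` stands for `min 1 ε'`. -/
def knownBound (t ε e : ℝ) : ℝ :=
  t / (ε * e) * Real.log (2 + t / (ε * e))

/-- The query bound for unknown `t`, where `e` stands for `min 1 ε'`. -/
def unknownBound (n : ℕ) (t ε e : ℝ) : ℝ :=
  ((t / e) ^ 3 + (t / e) ^ 2 * Real.log n) * (Real.log (2 + Real.log (2 + t / e)) / ε)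

end FrechetTesting

end

/-! Coarsening removes the scale of the edges. Keep every `s`-th vertex, with `s` of order `e * δ /
α` but at least `1`, and query at radius `ρ = δ + 2 * (s - 1) * α`. A coupling within `δ` projects
to a path of zeros in the sampled `m × m` matrix. Conversely, a sampled path with `k` ones between
two zero corners lifts to a coupling with at most `s * k` ones at radius `(1 + e) * δ`. Hence in a
far pair every such path satisfies `ε * m < 2 * k` (`lt_of_isFar`). Straightness makes the sampled
zeros local (`local_of_isStraight`): with `W` of order `γ * t / e`, zeros in columns `c` and `c'`
lie in rows that differ by at most `W * (1 + |c - c'|)`, and likewise with rows and columns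
exchanged.

The combinatorial core is `cReach_of_breaks`. Cut the columns greedily into maximal pieces that a
path of zeros can cross, and cut the rows in the same way. By locality a path can hop from piece to
piece at a cost of `O(W)` per piece. A far pair therefore has at least `m / L` breaks among its
columns or among its rows, where `L` is of order `W / ε`. Each break is witnessed by an interval
that no path of zeros crosses, and enough of these intervals have length at most `2 * L`. Random
windows of radii `2 ^ k`, about `A * L / 2 ^ k` of each, miss all of them with probability at most
`exp (-A / 4)` (`acc_sampleTest_scales_le`). The testers say "no" only if the replies exclude every
path of zeros, so close pairs are always accepted.

If `t` is unknown, a guess for `W` is doubled from round to round, and locality is itself tested. An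
index is compared only with `O(log m)` dyadic ancestors. Two indices have a common ancestor between
them, so the indices that pass are local to each other with constant `2 * W`. If many indices fail,
a random one reveals this and the next guess is tried, which is never an error. If few fail, their
zeros are discarded, and most of the resulting uncrossable intervals avoid them and so are
uncrossable in the full matrix (`acc_round_le`). Once the guess is large enough no check can fail,
so the costs form a geometric sum up to that round. Taking `A` of order `log (j + 2)` in round `j`
makes the error probabilities sum to at most `1 / 5`; this is the source of the iterated logarithm.
-/

namespace FrechetTesting

open Relation QueryAlgorithm

/-! ### Monotone lattice paths -/

/-- A step to the right, upwards, or diagonally. -/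
def Step (p q : ℕ × ℕ) : Prop :=
  (q.1 = p.1 + 1 ∧ q.2 = p.2) ∨ (q.1 = p.1 ∧ q.2 = p.2 + 1) ∨ (q.1 = p.1 + 1 ∧ q.2 = p.2 + 1)

/-- A step to a point of `Z`. -/
def ZStep (Z : ℕ → ℕ → Prop) (p q : ℕ × ℕ) : Prop := Step p q ∧ Z q.1 q.2

/-- There is a monotone path from `p` to `q` inside `Z`. -/
def ZPath (Z : ℕ → ℕ → Prop) (p q : ℕ × ℕ) : Prop := Z p.1 p.2 ∧ ReflTransGen (ZStep Z) p q

/-- There is a monotone path inside `Z` from column `a` to column `b`. -/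
def Crossable (Z : ℕ → ℕ → Prop) (a b : ℕ) : Prop := ∃ r r', ZPath Z (a, r) (b, r')

/-- There is a monotone path from `p` to `q` that visits at most `k` points outside `Z`, not
counting `p`. -/
inductive CReach (Z : ℕ → ℕ → Prop) : ℕ → ℕ × ℕ → ℕ × ℕ → Prop
  | refl (k p) : CReach Z k p p
  | free {k p q q'} : CReach Z k p q → Step q q' → Z q'.1 q'.2 → CReach Z k p q'
  | paid {k p q q'} : CReach Z k p q → Step q q' → CReach Z (k + 1) p q'

/-- The transposed relation. -/
def transp (Z : ℕ → ℕ → Prop) (i j : ℕ) : Prop := Z j i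

section Lattice

variable {Z Z' : ℕ → ℕ → Prop} {m W : ℕ}

lemma Step.swap {p q : ℕ × ℕ} (h : Step p q) : Step p.swap q.swap := by
  unfold Step at *; simp only [Prod.fst_swap, Prod.snd_swap]; tauto

lemma Step.le {p q : ℕ × ℕ} (h : Step p q) : p.1 ≤ q.1 ∧ p.2 ≤ q.2 := by
  unfold Step at h; omega

lemma reflTransGen_swap {p q : ℕ × ℕ} (h : ReflTransGen (ZStep Z) p q) :
    ReflTransGen (ZStep (transp Z)) p.swap q.swap := by
  induction h with
  | refl => exact .refl
  | tail _ h ih => exact ih.tail ⟨h.1.swap, h.2⟩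

lemma ZPath.swap {p q : ℕ × ℕ} (h : ZPath Z p q) : ZPath (transp Z) p.swap q.swap :=
  ⟨h.1, reflTransGen_swap h.2⟩

lemma CReach.swap {k : ℕ} {p q : ℕ × ℕ} (h : CReach Z k p q) :
    CReach (transp Z) k p.swap q.swap := by
  induction h with
  | refl => exact .refl _ _
  | free _ hs hz ih => exact .free ih hs.swap hz
  | paid _ hs ih => exact .paid ih hs.swap

lemma reflTransGen_le {p q : ℕ × ℕ} (h : ReflTransGen (ZStep Z) p q) : p.1 ≤ q.1 ∧ p.2 ≤ q.2 := by
  induction h with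
  | refl => exact ⟨le_rfl, le_rfl⟩
  | tail _ h ih => exact ⟨ih.1.trans h.1.le.1, ih.2.trans h.1.le.2⟩

lemma reflTransGen_mem {p q : ℕ × ℕ} (hp : Z p.1 p.2) (h : ReflTransGen (ZStep Z) p q) :
    Z q.1 q.2 := by
  cases h with
  | refl => exact hp
  | tail _ h => exact h.2

lemma ZPath.right {p q : ℕ × ℕ} (h : ZPath Z p q) : Z q.1 q.2 := reflTransGen_mem h.1 h.2

/-- A path visits every column between its end points. -/
lemma ZPath.exists_column {p q : ℕ × ℕ} (h : ZPath Z p q) {a : ℕ} (h1 : p.1 ≤ a) (h2 : a ≤ q.1) :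
    ∃ r, ZPath Z p (a, r) ∧ ZPath Z (a, r) q := by
  obtain ⟨hp, h⟩ := h
  induction h with
  | refl =>
    have : p.1 = a := le_antisymm h1 h2
    subst this
    exact ⟨p.2, ⟨hp, .refl⟩, ⟨hp, .refl⟩⟩
  | @tail b c hb hs ih =>
    rcases Nat.lt_or_ge b.1 a with hlt | hge
    · have : c.1 = a := by have := hs.1; unfold Step at this; omega
      subst this
      exact ⟨c.2, ⟨hp, hb.tail hs⟩, ⟨hs.2, .refl⟩⟩
    · obtain ⟨r, hr1, hr2⟩ := ih hge
      exact ⟨r, hr1, hr2.1, hr2.2.tail hs⟩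

/-- A path inside `Z` whose points in the range of columns that it traverses lie in `Z'` is a path
inside `Z'`. -/
lemma ZPath.mono {p q : ℕ × ℕ} (h : ZPath Z p q)
    (hZ : ∀ x y, p.1 ≤ x → x ≤ q.1 → p.2 ≤ y → y ≤ q.2 → Z x y → Z' x y) : ZPath Z' p q := by
  obtain ⟨hp, h⟩ := h
  induction h with
  | refl => exact ⟨hZ _ _ le_rfl le_rfl le_rfl le_rfl hp, .refl⟩
  | @tail b c hb hs ih =>
    have hle := reflTransGen_le hb
    have hle' := hs.1.le
    obtain ⟨h1, h2⟩ := ih fun x y h1 h2 h3 h4 => hZ x y h1 (h2.trans hle'.1) h3 (h4.trans hle'.2)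
    exact ⟨h1, h2.tail ⟨hs.1, hZ _ _ (hle.1.trans hle'.1) le_rfl (hle.2.trans hle'.2) le_rfl hs.2⟩⟩

lemma Crossable.of_path {p q : ℕ × ℕ} (h : ZPath Z p q) {a b : ℕ} (h1 : p.1 ≤ a) (hab : a ≤ b)
    (h2 : b ≤ q.1) : Crossable Z a b := by
  obtain ⟨r, hr1, hr2⟩ := h.exists_column h1 (hab.trans h2)
  obtain ⟨r', hr3, -⟩ := hr2.exists_column hab h2
  exact ⟨r, r', hr3⟩

lemma Crossable.mono {a b : ℕ} (h : Crossable Z a b)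
    (hZ : ∀ x y, a ≤ x → x ≤ b → Z x y → Z' x y) : Crossable Z' a b := by
  obtain ⟨r, r', h⟩ := h
  exact ⟨r, r', h.mono fun x y h1 h2 _ _ => hZ x y h1 h2⟩

lemma CReach.mono {p q : ℕ × ℕ} {k l : ℕ} (h : CReach Z k p q) (hkl : k ≤ l) :
    CReach Z l p q := by
  induction h generalizing l with
  | refl => exact .refl _ _
  | free _ hs hz ih => exact .free (ih hkl) hs hz
  | paid _ hs ih =>
    obtain ⟨l, rfl⟩ : ∃ l', l = l' + 1 := ⟨l - 1, by omega⟩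
    exact .paid (ih (by omega)) hs

lemma CReach.trans {k l : ℕ} {p q z : ℕ × ℕ} (h : CReach Z k p q) (h' : CReach Z l q z) :
    CReach Z (k + l) p z := by
  induction h' with
  | refl => exact h.mono (Nat.le_add_right _ _)
  | free _ hs hz ih => exact .free (ih h) hs hz
  | paid _ hs ih => exact .paid (ih h) hs

lemma CReach.mono_set {p q : ℕ × ℕ} {k : ℕ} (h : CReach Z k p q)
    (hZ : ∀ x y, Z x y → Z' x y) : CReach Z' k p q := by
  induction h with
  | refl => exact .refl _ _
  | free _ hs hz ih => exact .free ih hs (hZ _ _ hz)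
  | paid _ hs ih => exact .paid ih hs

lemma ZPath.cReach {p q : ℕ × ℕ} (h : ZPath Z p q) : CReach Z 0 p q := by
  obtain ⟨-, h⟩ := h
  induction h with
  | refl => exact .refl _ _
  | tail _ hs ih => exact .free ih hs.1 hs.2

lemma CReach.right (Z : ℕ → ℕ → Prop) (c r d : ℕ) : CReach Z d (c, r) (c + d, r) := by
  induction d with
  | zero => exact .refl _ _
  | succ d ih => exact .paid ih (Or.inl ⟨by simp; omega, rfl⟩)

lemma CReach.rect (Z : ℕ → ℕ → Prop) {c r c' r' : ℕ} (hc : c ≤ c') (hr : r ≤ r') :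
    CReach Z ((c' - c) + (r' - r)) (c, r) (c', r') := by
  obtain ⟨d, rfl⟩ := Nat.exists_eq_add_of_le hc
  obtain ⟨e, rfl⟩ := Nat.exists_eq_add_of_le hr
  exact ((CReach.right Z c r d).trans (CReach.right (transp Z) r (c + d) e).swap).mono (by omega)

/-! ### Sweeps and the cost of an optimal path -/

/-- Zeros in the same column or row are close to each other, and zeros in nearby columns or rows
are in nearby rows or columns. -/
structure Local (Z : ℕ → ℕ → Prop) (m W : ℕ) : Prop where
  lt : ∀ {c r}, Z c r → c < m ∧ r < m
  col : ∀ {c r c' r'}, Z c r → Z c' r' → r' ≤ r + W * (1 + (c - c') + (c' - c))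
  row : ∀ {c r c' r'}, Z c r → Z c' r' → c' ≤ c + W * (1 + (r - r') + (r' - r))

lemma Local.transp (h : Local Z m W) : Local (transp Z) m W :=
  ⟨fun hz => (h.lt hz).symm, fun h1 h2 => h.row h1 h2, fun h1 h2 => h.col h1 h2⟩

/-- A division of the columns into numbered pieces (`idx` is the number of the piece), such that
from the zeros in `S` one can travel at no cost to the last column of the piece. -/
structure Sweep (Z : ℕ → ℕ → Prop) (m : ℕ) (idx : ℕ → ℕ) (S : ℕ → ℕ → Prop) : Prop where
  mono : Monotone idx
  sub : ∀ {x y}, S x y → Z x y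
  cover : ∀ {x y}, Z x y → ∃ y', S x y'
  empty : ∀ x, x + 1 < m → (∀ y, ¬ Z (x + 1) y) → idx x < idx (x + 1)
  follow : ∀ {x y}, S x y → ∃ x' y', Z x' y' ∧ x ≤ x' ∧ y ≤ y' ∧ idx x' = idx x ∧
    idx x' < idx (x' + 1) ∧ CReach Z 0 (x, y) (x', y')

section Sweeps

variable {idx idx' : ℕ → ℕ} {S S' : ℕ → ℕ → Prop}

/-- Every empty column opens a new piece, so the distance back to the last nonempty column is
charged to the growth of `idx`. -/
lemma Sweep.exists_last (hS : Sweep Z m idx S) {c r x : ℕ} (hz : Z c r) (hcx : c ≤ x) (hx : x < m)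
    (hlow : ∀ x', c < x' → x' ≤ x → ∀ y, S x' y → y < r) :
    ∃ x0 y0, c ≤ x0 ∧ x0 ≤ x ∧ Z x0 y0 ∧ y0 ≤ r ∧ x + idx c ≤ x0 + idx x := by
  induction x, hcx using Nat.le_induction with
  | base => exact ⟨c, r, le_rfl, le_rfl, hz, le_rfl, le_rfl⟩
  | succ x hcx ih =>
    by_cases he : ∃ y, Z (x + 1) y
    · obtain ⟨y, hy⟩ := he
      obtain ⟨y', hy'⟩ := hS.cover hy
      have := hS.mono (show c ≤ x + 1 by omega)
      exact ⟨x + 1, y', by omega, le_rfl, hS.sub hy',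
        (hlow _ (by omega) le_rfl _ hy').le, by omega⟩
    · push Not at he
      have := hS.empty x hx he
      obtain ⟨x0, y0, h1, h2, h3, h4, h5⟩ := ih (by omega) fun x' h1 h2 => hlow x' h1 (by omega)
      exact ⟨x0, y0, h1, by omega, h3, h4, by omega⟩

/-- The last nonempty column before `x1` has a zero at height at most `r`; locality between it and
`x1` bounds the rise. -/
lemma Sweep.rise_le (hL : Local Z m W) (hS : Sweep Z m idx S) {c r x1 y1 : ℕ} (hz : Z c r)
    (hx1 : c < x1) (h1 : S x1 y1) (hlow : ∀ x, c < x → x < x1 → ∀ y, S x y → y < r) :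
    y1 ≤ r + W * (2 + (idx x1 - idx c)) := by
  have hm := (hL.lt (hS.sub h1)).1
  obtain ⟨x0, y0, h2, h3, h4, h5, h6⟩ := hS.exists_last hz (show c ≤ x1 - 1 by omega) (by omega)
    fun x' h1 h2 => hlow x' h1 (by omega)
  have h7 := hL.col h4 (hS.sub h1)
  have h8 := hS.mono (show x1 - 1 ≤ x1 by omega)
  have : W * (1 + (x0 - x1) + (x1 - x0)) ≤ W * (2 + (idx x1 - idx c)) :=
    Nat.mul_le_mul_left _ (by omega)
  omega

/-- One step of the induction: pay for the rectangle from `(c, r)` to `(x1, y1)`, then travel free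
to the end of the piece of `x1`. The width of the rectangle depends on the row division and is left
to the caller as `hright`. -/
lemma cReach_of_columnMove (hL : Local Z m W) (hS : Sweep Z m idx S)
    (hS' : Sweep (transp Z) m idx' S') {N c r x1 y1 : ℕ} (hz : Z c r)
    (hN : 2 * idx m + 2 * idx' m ≤ N + (idx c + idx (c + 1)) + (idx' r + idx' (r + 1)))
    (ih : ∀ N' < N, ∀ c' r', Z c' r' →
      2 * idx m + 2 * idx' m ≤ N' + (idx c' + idx (c' + 1)) + (idx' r' + idx' (r' + 1)) →
      CReach Z (5 * W * N' + 2 * W) (c', r') (m - 1, m - 1))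
    (hx1 : c < x1) (h1 : S x1 y1) (hy1 : r ≤ y1)
    (hlow : ∀ x, c < x → x < x1 → ∀ y, S x y → y < r)
    (hright : x1 ≤ c + W * (2 + (idx' y1 - idx' r))) :
    CReach Z (5 * W * N + 2 * W) (c, r) (m - 1, m - 1) := by
  have hup := hS.rise_le hL hz hx1 h1 hlow
  obtain ⟨x2, y2, h2, h3, h4, h5, h6, h7⟩ := hS.follow h1
  have hm := hL.lt h2
  have e1 := hS.mono hx1.le
  have e2 := hS.mono (show c + 1 ≤ x2 by omega)
  have e4 := hS.mono (show x2 + 1 ≤ m by omega)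
  have f1 := hS'.mono hy1
  have f2 := hS'.mono h4
  have f3 := hS'.mono (show r + 1 ≤ y2 + 1 by omega)
  have f4 := hS'.mono (show y2 + 1 ≤ m by omega)
  have f5 := hS'.mono (show y2 ≤ y2 + 1 by omega)
  -- `D` is the gain in potential. The potential uses both `idx c` and `idx (c + 1)` so that it
  -- grows even if `x2` is in the piece of `c`: the walk ends at the last column of a piece, where
  -- `idx (x2 + 1) > idx x2 ≥ idx (c + 1)`.
  set D := (idx x2 + idx (x2 + 1)) + (idx' y2 + idx' (y2 + 1)) -
    ((idx c + idx (c + 1)) + (idx' r + idx' (r + 1))) with hD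
  have hDN : D ≤ N := by omega
  have key := ih (N - D) (by omega) x2 y2 h2 (by omega)
  refine (((CReach.rect Z hx1.le hy1).trans h7).trans key).mono ?_
  have a1 : x1 - c ≤ W * (2 + (idx' y1 - idx' r)) := by omega
  have a2 : y1 - r ≤ W * (2 + (idx x1 - idx c)) := by omega
  -- With `a` and `b` the two differences of piece numbers, `D ≥ a + b + 1`, hence `4 + a + b ≤ 5 *
  -- D`.
  have a3 : W * (2 + (idx' y1 - idx' r)) + W * (2 + (idx x1 - idx c)) ≤ W * (5 * D) := by
    rw [← Nat.mul_add]; exact Nat.mul_le_mul_left _ (by omega)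
  obtain ⟨N', rfl⟩ := Nat.exists_eq_add_of_le hDN
  have a4 : 5 * W * (D + N') = W * (5 * D) + 5 * W * N' := by ring
  rw [Nat.add_sub_cancel_left]
  omega

lemma CReach.of_transp {k : ℕ} {p q : ℕ × ℕ} (h : CReach (transp Z) k p.swap q.swap) :
    CReach Z k p q := h.swap

/-- The cost of an optimal path is bounded by the number of pieces of the columns and rows. -/
theorem cReach_of_sweeps (hL : Local Z m W) (hS : Sweep Z m idx S)
    (hS' : Sweep (transp Z) m idx' S') (hend : Z (m - 1) (m - 1)) (N : ℕ) :
    ∀ c r : ℕ, Z c r →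
      2 * idx m + 2 * idx' m ≤ N + (idx c + idx (c + 1)) + (idx' r + idx' (r + 1)) →
      CReach Z (5 * W * N + 2 * W) (c, r) (m - 1, m - 1) := by
  induction N using Nat.strong_induction_on with
  | _ N ih =>
  intro c r hz hN
  have hcr := hL.lt hz
  have colMove : ∀ x1 y1, c < x1 → S x1 y1 → r ≤ y1 →
      (∀ x, c < x → x < x1 → ∀ y, S x y → y < r) → x1 ≤ c + W * (2 + (idx' y1 - idx' r)) →
      CReach Z (5 * W * N + 2 * W) (c, r) (m - 1, m - 1) :=
    fun x1 y1 => cReach_of_columnMove hL hS hS' hz hN ih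
  have rowMove : ∀ y1 x1, r < y1 → S' y1 x1 → c ≤ x1 →
      (∀ y, r < y → y < y1 → ∀ x, S' y x → x < c) → y1 ≤ r + W * (2 + (idx x1 - idx c)) →
      CReach Z (5 * W * N + 2 * W) (c, r) (m - 1, m - 1) := fun y1 x1 h1 h2 h3 h4 h5 =>
    (cReach_of_columnMove (c := r) (r := c) hL.transp hS' hS hz (by omega)
      (fun N' hN' c' r' hz' h => (ih N' hN' r' c' hz' (by omega)).swap) h1 h2 h3 h4 h5).of_transp
  have first : ∀ (T : ℕ → ℕ → Prop) (a b : ℕ),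
      (∀ x, a < x → ∀ y, T x y → y < b) ∨
      ∃ x1 y1, a < x1 ∧ T x1 y1 ∧ b ≤ y1 ∧ ∀ x, a < x → x < x1 → ∀ y, T x y → y < b := by
    intro T a b
    by_cases h : ∃ x, a < x ∧ ∃ y, T x y ∧ b ≤ y
    · classical
      right
      obtain ⟨h1, y, h2, h3⟩ := Nat.find_spec h
      refine ⟨Nat.find h, y, h1, h2, h3, fun x hx hlt y' hy' => ?_⟩
      by_contra hcon
      exact Nat.find_min h hlt ⟨hx, y', hy', by omega⟩
    · left
      intro x hx y hy
      by_contra hcon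
      exact h ⟨x, hx, y, hy, by omega⟩
  have hW2 : ∀ e, W * (1 + 0 + 0) ≤ W * (2 + e) := fun e => Nat.mul_le_mul_left _ (by omega)
  -- Compare the first column right of `c` with an `S`-zero not below `r` and the first row above
  -- `r` with an `S'`-zero not left of `c`. If neither exists, locality puts the final corner within
  -- `W` in both directions. If both exist, the column move is taken when `y1 < q1` and the row move
  -- otherwise; this order makes the side length that is not yet bounded follow from locality.
  rcases first S c r with hno | ⟨x1, y1, hx1, h1, hy1, hlow⟩
  · rcases first S' r c with hno' | ⟨q1, p1, hq1, g1, hp1, glow⟩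
    · have k1 : m - 1 ≤ r + W := by
        rcases Nat.lt_or_ge c (m - 1) with hlt | hge
        · obtain ⟨y, hy⟩ := hS.cover hend
          have := hno _ hlt _ hy
          have := hL.col (hS.sub hy) hend
          rw [Nat.sub_self] at this
          omega
        · obtain rfl : c = m - 1 := by omega
          have := hL.col hz hend
          rw [Nat.sub_self] at this
          omega
      have k2 : m - 1 ≤ c + W := by
        rcases Nat.lt_or_ge r (m - 1) with hlt | hge
        · obtain ⟨y, hy⟩ := hS'.cover hend
          have := hno' _ hlt _ hy
          have := hL.row (hS'.sub hy) hend
          rw [Nat.sub_self] at this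
          omega
        · obtain rfl : r = m - 1 := by omega
          have := hL.row hz hend
          rw [Nat.sub_self] at this
          omega
      exact (CReach.rect Z (show c ≤ m - 1 by omega) (show r ≤ m - 1 by omega)).mono (by omega)
    · refine rowMove q1 p1 hq1 g1 hp1 glow ?_
      have hz1 := hS'.sub g1
      have := hW2 (idx p1 - idx c)
      rcases hp1.eq_or_lt with rfl | hlt
      · have := hL.col hz hz1
        rw [Nat.sub_self] at this
        omega
      · obtain ⟨y, hy⟩ := hS.cover hz1
        have := hno _ hlt _ hy
        have := hL.col (hS.sub hy) hz1
        rw [Nat.sub_self] at this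
        omega
  · have hz1 := hS.sub h1
    have hrow : (∀ y, r < y → y ≤ y1 → ∀ x, S' y x → x < c) →
        x1 ≤ c + W * (2 + (idx' y1 - idx' r)) := by
      intro hl
      have := hW2 (idx' y1 - idx' r)
      rcases hy1.eq_or_lt with rfl | hlt
      · have := hL.row hz hz1
        rw [Nat.sub_self] at this
        omega
      · obtain ⟨x, hx⟩ := hS'.cover hz1
        have := hl _ hlt le_rfl _ hx
        have := hL.row (hS'.sub hx) hz1
        rw [Nat.sub_self] at this
        omega
    rcases first S' r c with hno' | ⟨q1, p1, hq1, g1, hp1, glow⟩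
    · exact colMove x1 y1 hx1 h1 hy1 hlow (hrow fun y h _ => hno' y h)
    · rcases Nat.lt_or_ge y1 q1 with hlt | hge
      · exact colMove x1 y1 hx1 h1 hy1 hlow (hrow fun y h h' => glow y h (by omega))
      · refine rowMove q1 p1 hq1 g1 hp1 glow ?_
        have hzq := hS'.sub g1
        rcases Nat.lt_or_ge p1 x1 with hpx | hpx
        · have := hW2 (idx p1 - idx c)
          rcases hp1.eq_or_lt with rfl | hlt
          · have := hL.col hz hzq
            rw [Nat.sub_self] at this
            omega
          · obtain ⟨y, hy⟩ := hS.cover hzq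
            have := hlow _ hlt hpx _ hy
            have := hL.col (hS.sub hy) hzq
            rw [Nat.sub_self] at this
            omega
        · have := hS.rise_le hL hz hx1 h1 hlow
          have : W * (2 + (idx x1 - idx c)) ≤ W * (2 + (idx p1 - idx c)) := by
            have := hS.mono hpx
            exact Nat.mul_le_mul_left _ (by omega)
          omega

end Sweeps

/-! ### Greedy pieces -/

open Classical in
/-- The first column of the piece of column `x`, where a new piece is started whenever the current
one cannot be continued by a path inside `Z`. -/
noncomputable def pieceStart (Z : ℕ → ℕ → Prop) : ℕ → ℕ
  | 0 => 0
  | x + 1 => if Crossable Z (pieceStart Z x) (x + 1) then pieceStart Z x else x + 1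

open Classical in
/-- The columns, among the first `k`, that are the last ones of their pieces. -/
noncomputable def breaks (Z : ℕ → ℕ → Prop) (k : ℕ) : Finset ℕ :=
  (Finset.range k).filter fun x => ¬ Crossable Z (pieceStart Z x) (x + 1)

lemma mem_breaks {k x : ℕ} : x ∈ breaks Z k ↔ x < k ∧ ¬ Crossable Z (pieceStart Z x) (x + 1) := by
  simp [breaks]

lemma card_breaks_succ (Z : ℕ → ℕ → Prop) (k : ℕ) [Decidable (Crossable Z (pieceStart Z k) (k + 1))] :
    (breaks Z (k + 1)).card =
      if Crossable Z (pieceStart Z k) (k + 1) then (breaks Z k).card else (breaks Z k).card + 1 := by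
  unfold breaks
  rw [Finset.range_add_one, Finset.filter_insert]
  split_ifs <;> simp_all

lemma pieceStart_le (Z : ℕ → ℕ → Prop) (x : ℕ) : pieceStart Z x ≤ x := by
  induction x with
  | zero => exact le_rfl
  | succ x ih => rw [pieceStart]; split_ifs <;> omega

lemma pieceStart_mono (Z : ℕ → ℕ → Prop) : Monotone (pieceStart Z) :=
  monotone_nat_of_le_succ fun x => by
    have := pieceStart_le Z x
    rw [pieceStart]; split_ifs <;> omega

lemma crossable_pieceStart (Z : ℕ → ℕ → Prop) (x : ℕ) :
    Crossable Z (pieceStart Z x) x ∨ pieceStart Z x = x := by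
  cases x with
  | zero => exact Or.inr rfl
  | succ x => rw [pieceStart]; split_ifs with h <;> simp [h]

lemma card_breaks_mono (Z : ℕ → ℕ → Prop) : Monotone fun k => (breaks Z k).card :=
  monotone_nat_of_le_succ fun k => by
    classical
    have := card_breaks_succ Z k
    split_ifs at this <;> omega

lemma not_crossable_of_empty {a b : ℕ} (h : ∀ y, ¬ Z b y) : ¬ Crossable Z a b :=
  fun ⟨_, _, hp⟩ => h _ hp.right

lemma card_breaks_lt_iff (x : ℕ) :
    (breaks Z x).card < (breaks Z (x + 1)).card ↔ ¬ Crossable Z (pieceStart Z x) (x + 1) := by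
  classical
  rw [card_breaks_succ]
  split_ifs with h <;> simp [h]

/-- The chosen zeros are those with a free path to the end of their piece. Each nonempty column has
one, because a path crossing the whole piece visits that column. -/
lemma sweep_pieces (hlt : ∀ {c r}, Z c r → c < m ∧ r < m) :
    Sweep Z m (fun k => (breaks Z k).card) fun x y => Z x y ∧ ∃ x' y',
      (breaks Z x').card = (breaks Z x).card ∧ (breaks Z x').card < (breaks Z (x' + 1)).card ∧
      ZPath Z (x, y) (x', y') where
  mono := card_breaks_mono Z
  sub h := h.1
  cover := by
    classical
    intro x y hz
    have hx := hlt hz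
    -- Column `m` contains no zero, so the piece of `x` ends at `m - 1` at the latest.
    have hex : ∃ x', x ≤ x' ∧ ¬ Crossable Z (pieceStart Z x') (x' + 1) :=
      ⟨m - 1, by omega, not_crossable_of_empty fun y hy => by have := hlt hy; omega⟩
    obtain ⟨h1, h2⟩ := Nat.find_spec hex
    set x' := Nat.find hex
    have hstep : ∀ k, x ≤ k → k ≤ x' →
        pieceStart Z k = pieceStart Z x ∧ (breaks Z k).card = (breaks Z x).card := by
      intro k hk
      induction k, hk using Nat.le_induction with
      | base => exact fun _ => ⟨rfl, rfl⟩
      | succ k hk ih =>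
        intro hkx
        obtain ⟨e1, e2⟩ := ih (by omega)
        have hc : Crossable Z (pieceStart Z k) (k + 1) := by
          by_contra hcon
          exact Nat.find_min hex (show k < x' by omega) ⟨hk, hcon⟩
        rw [pieceStart, card_breaks_succ, if_pos hc, if_pos hc]
        exact ⟨e1, e2⟩
    obtain ⟨e1, e2⟩ := hstep x' h1 le_rfl
    have hs := pieceStart_le Z x
    rcases crossable_pieceStart Z x' with ⟨r, r', hp⟩ | heq
    · obtain ⟨ρ, -, hp⟩ := hp.exists_column (a := x) (by simp only; omega) h1
      exact ⟨ρ, hp.1, x', r', e2, (card_breaks_lt_iff _).2 h2, hp⟩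
    · have hx' : x' = x := by omega
      refine ⟨y, hz, x', y, e2, (card_breaks_lt_iff _).2 h2, ?_⟩
      rw [hx']
      exact ⟨hz, .refl⟩
  empty x _ h := (card_breaks_lt_iff _).2 (not_crossable_of_empty h)
  follow := by
    rintro x y ⟨hz, x', y', h1, h2, h3⟩
    have := reflTransGen_le h3.2
    exact ⟨x', y', h3.right, this.1, this.2, h1, h2, h3.cReach⟩

/-- A path from corner to corner whose cost is bounded by the numbers of breaks. -/
theorem cReach_of_breaks (hL : Local Z m W) (h0 : Z 0 0) (hend : Z (m - 1) (m - 1)) :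
    CReach Z (10 * W * ((breaks Z (m - 1)).card + (breaks (transp Z) (m - 1)).card) + 22 * W)
      (0, 0) (m - 1, m - 1) := by
  have hm : m - 1 + 1 = m := by have := hL.lt h0; omega
  have hlast : ∀ Y : ℕ → ℕ → Prop, (∀ {c r}, Y c r → c < m ∧ r < m) →
      (breaks Y m).card = (breaks Y (m - 1)).card + 1 := by
    classical
    intro Y hlt
    have := card_breaks_succ Y (m - 1)
    rwa [hm, if_neg (not_crossable_of_empty fun y hy => by have := hlt hy; omega)] at this
  -- The potential is at most twice each total of breaks. Column `m` adds one break to each total,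
  -- which gives `5 * W * 4 + 2 * W = 22 * W`.
  refine (cReach_of_sweeps hL (sweep_pieces (Z := Z) fun h => hL.lt h) (sweep_pieces hL.transp.lt) hend
    (2 * (breaks Z m).card + 2 * (breaks (transp Z) m).card) 0 0 h0 (by omega)).mono ?_
  rw [hlast Z hL.lt, hlast _ hL.transp.lt]
  apply le_of_eq
  ring

end Lattice

/-! ### Probability of acceptance -/

section Acceptance

variable {n : ℕ} {M : Fin n → Fin n → ℕ}

/-- The probability that the answer is "yes". -/
noncomputable def acc (M : Fin n → Fin n → ℕ) (A : QueryAlgorithm n) : ℝ := (A.output M true).toReal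

lemma acc_nonneg (A : QueryAlgorithm n) : 0 ≤ acc M A := ENNReal.toReal_nonneg

lemma acc_le_one (A : QueryAlgorithm n) : acc M A ≤ 1 :=
  ENNReal.toReal_mono ENNReal.one_ne_top (PMF.coe_le_one _ _)

@[simp] lemma acc_true : acc M (.answer true) = 1 := by simp [acc, output]

@[simp] lemma acc_false : acc M (.answer false) = 0 := by simp [acc, output]

lemma acc_draw (k : ℕ) (next : Fin (k + 1) → QueryAlgorithm n) :
    acc M (.draw k next) = (∑ r, acc M (next r)) / (k + 1) := by
  simp only [acc, output, PMF.bind_apply, tsum_fintype, PMF.uniformOfFintype_apply]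
  rw [ENNReal.toReal_sum fun r _ => ENNReal.mul_ne_top (by simp) (PMF.apply_ne_top _ _)]
  simp [ENNReal.toReal_mul, ← Finset.mul_sum, div_eq_inv_mul]
  left
  norm_cast

lemma output_true_eq_one {A : QueryAlgorithm n} (h : acc M A = 1) : A.output M true = 1 := by
  rw [acc] at h
  rw [← ENNReal.ofReal_toReal (PMF.apply_ne_top _ _), h, ENNReal.ofReal_one]

lemma output_false_ge {A : QueryAlgorithm n} (h : acc M A ≤ 1 / 5) :
    4 / 5 ≤ A.output M false := by
  have h1 : A.output M true + A.output M false = 1 := by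
    have := (A.output M).tsum_coe
    rwa [tsum_fintype, Fintype.sum_bool] at this
  have h2 : acc M A + (A.output M false).toReal = 1 := by
    rw [acc, ← ENNReal.toReal_add (PMF.apply_ne_top _ _) (PMF.apply_ne_top _ _), h1,
      ENNReal.toReal_one]
  rw [← ENNReal.ofReal_toReal (PMF.apply_ne_top (A.output M) false)]
  have : (4 / 5 : ENNReal) = ENNReal.ofReal (4 / 5) := by
    rw [ENNReal.ofReal_div_of_pos (by norm_num)]; simp
  rw [this]
  exact ENNReal.ofReal_le_ofReal (by linarith)

/-- Draw a uniformly random index below `m`. -/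
def drawIndex (m : ℕ) (next : ℕ → QueryAlgorithm n) : QueryAlgorithm n :=
  .draw (m - 1) fun r => next r

lemma acc_drawIndex {m : ℕ} (hm : 0 < m) (next : ℕ → QueryAlgorithm n) :
    acc M (drawIndex m next) = (∑ y ∈ Finset.range m, acc M (next y)) / m := by
  obtain ⟨k, rfl⟩ : ∃ k, m = k + 1 := ⟨m - 1, by omega⟩
  rw [drawIndex, Nat.add_sub_cancel, acc_draw, Finset.sum_range]
  push_cast
  rfl

lemma queryCount_drawIndex_le {m B : ℕ} (hm : 0 < m) (next : ℕ → QueryAlgorithm n)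
    (h : ∀ y < m, (next y).queryCount M ≤ B) : (drawIndex m next).queryCount M ≤ B := by
  rw [drawIndex, queryCount]
  exact Finset.sup_le fun r _ => h r (by have := r.2; omega)

end Acceptance

/-! ### Probes -/

/-- What is known about the set `Z` of zeros after inspecting the columns and rows in `S`, where
unknown entries are regarded as zeros. -/
def reveal (Z : ℕ → ℕ → Prop) (m : ℕ) (S : List ℕ) (i j : ℕ) : Prop :=
  i < m ∧ j < m ∧ (i ∈ S ∨ j ∈ S → Z i j)

/-- There is a path from corner to corner inside `V`. -/
def Consistent (m : ℕ) (V : ℕ → ℕ → Prop) : Prop := ZPath V (0, 0) (m - 1, m - 1)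

/-- The zeros of the submatrix with the columns and rows `ι 0, …, ι (m - 1)`. -/
def zeroRel {n : ℕ} (ι : ℕ → Fin n) (m : ℕ) (M : Fin n → Fin n → ℕ) (i j : ℕ) : Prop :=
  i < m ∧ j < m ∧ M (ι i) (ι j) = 0

section Reveal

variable {Z : ℕ → ℕ → Prop} {m : ℕ} {S S' : List ℕ}

lemma Consistent.mono {V V' : ℕ → ℕ → Prop} (h : Consistent m V) (hV : ∀ i j, V i j → V' i j) :
    Consistent m V' :=
  ZPath.mono h fun x y _ _ _ _ => hV x y

lemma Consistent.reveal (hZ : ∀ {i j}, Z i j → i < m ∧ j < m) (h : Consistent m Z) :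
    Consistent m (reveal Z m S) :=
  h.mono fun _ _ hz => ⟨(hZ hz).1, (hZ hz).2, fun _ => hz⟩

lemma Consistent.of_subset (h : Consistent m (FrechetTesting.reveal Z m S')) (hS : S ⊆ S') :
    Consistent m (FrechetTesting.reveal Z m S) :=
  h.mono fun _ _ hz => ⟨hz.1, hz.2.1, fun hm => hz.2.2 (hm.imp (@hS _) (@hS _))⟩

lemma Consistent.transp (h : Consistent m (FrechetTesting.reveal Z m S)) :
    Consistent m (FrechetTesting.reveal (transp Z) m S) :=
  Consistent.mono (ZPath.swap h) fun _ _ hz => ⟨hz.2.1, hz.1, fun hm => hz.2.2 hm.symm⟩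

lemma reveal_column (hZ : ∀ {i j}, Z i j → i < m ∧ j < m) {i : ℕ} (hi : i ∈ S) (j : ℕ) :
    reveal Z m S i j ↔ Z i j :=
  ⟨fun h => h.2.2 (Or.inl hi), fun h => ⟨(hZ h).1, (hZ h).2, fun _ => h⟩⟩

lemma reveal_row (hZ : ∀ {i j}, Z i j → i < m ∧ j < m) {j : ℕ} (hj : j ∈ S) (i : ℕ) :
    reveal Z m S i j ↔ Z i j :=
  ⟨fun h => h.2.2 (Or.inr hj), fun h => ⟨(hZ h).1, (hZ h).2, fun _ => h⟩⟩

lemma Consistent.exists_column (h : Consistent m (FrechetTesting.reveal Z m S)) {i : ℕ}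
    (hi : i ∈ S) (him : i < m) : ∃ j, Z i j := by
  obtain ⟨r, hr, -⟩ := ZPath.exists_column h (a := i) (Nat.zero_le _) (by simp only; omega)
  exact ⟨r, hr.right.2.2 (Or.inl hi)⟩

lemma Consistent.crossable (h : Consistent m (FrechetTesting.reveal Z m S)) {a b : ℕ}
    (hab : a ≤ b) (hb : b < m) (hS : ∀ i, a ≤ i → i ≤ b → i ∈ S) : Crossable Z a b :=
  (Crossable.of_path h (Nat.zero_le _) hab (by simp only; omega)).mono
    fun x _ h1 h2 h3 => h3.2.2 (Or.inl (hS x h1 h2))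

lemma Consistent.corners (h : Consistent m (FrechetTesting.reveal Z m S)) (h0 : 0 ∈ S)
    (h1 : m - 1 ∈ S) : Z 0 0 ∧ Z (m - 1) (m - 1) :=
  ⟨h.1.2.2 (Or.inl h0), (ZPath.right h).2.2 (Or.inl h1)⟩

end Reveal

/-! ### The building blocks of the testers, and acceptance of close pairs. -/

section Algorithms

variable {n : ℕ} (ι : ℕ → Fin n) (m : ℕ)

/-- Query all columns and rows with indices in a list, and continue with the resulting
knowledge. -/
def probe : List ℕ → ((ℕ → ℕ → Prop) → QueryAlgorithm n) → QueryAlgorithm n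
  | [], K => K fun i j => i < m ∧ j < m
  | a :: S, K => .queryColumn (ι a) fun A => .queryRow (ι a) fun B =>
      probe S fun V => K fun i j => V i j ∧ (i = a → ι j ∈ A) ∧ (j = a → ι i ∈ B)

lemma zeroRel_lt {M : Fin n → Fin n → ℕ} {i j : ℕ} (h : zeroRel ι m M i j) : i < m ∧ j < m :=
  ⟨h.1, h.2.1⟩

lemma reveal_cons (M : Fin n → Fin n → ℕ) (a : ℕ) (S : List ℕ) :
    (fun i j => reveal (zeroRel ι m M) m S i j ∧ (i = a → ι j ∈ columnZeros M (ι a)) ∧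
      (j = a → ι i ∈ rowZeros M (ι a))) = reveal (zeroRel ι m M) m (a :: S) := by
  funext i j
  simp only [reveal, zeroRel, columnZeros, rowZeros, Finset.mem_filter, Finset.mem_univ, true_and,
    List.mem_cons, eq_iff_iff]
  constructor
  · rintro ⟨⟨h1, h2, h3⟩, h4, h5⟩
    refine ⟨h1, h2, ?_⟩
    rintro ((rfl | h) | (rfl | h))
    · exact ⟨h1, h2, h4 rfl⟩
    · exact h3 (Or.inl h)
    · exact ⟨h1, h2, h5 rfl⟩
    · exact h3 (Or.inr h)
  · rintro ⟨h1, h2, h3⟩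
    refine ⟨⟨h1, h2, fun h => h3 (h.imp Or.inr Or.inr)⟩, ?_, ?_⟩
    · rintro rfl
      exact (h3 (Or.inl (Or.inl rfl))).2.2
    · rintro rfl
      exact (h3 (Or.inr (Or.inl rfl))).2.2

lemma reveal_nil (M : Fin n → Fin n → ℕ) :
    (fun i j => i < m ∧ j < m) = reveal (zeroRel ι m M) m [] := by
  funext i j
  simp [reveal]

lemma output_probe (M : Fin n → Fin n → ℕ) (S : List ℕ) (K : (ℕ → ℕ → Prop) → QueryAlgorithm n) :
    (probe ι m S K).output M = (K (reveal (zeroRel ι m M) m S)).output M := by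
  induction S generalizing K with
  | nil => rw [probe, reveal_nil ι m M]
  | cons a S ih => rw [probe, output, output, ih, reveal_cons]

lemma queryCount_probe (M : Fin n → Fin n → ℕ) (S : List ℕ)
    (K : (ℕ → ℕ → Prop) → QueryAlgorithm n) :
    (probe ι m S K).queryCount M =
      2 * S.length + (K (reveal (zeroRel ι m M) m S)).queryCount M := by
  induction S generalizing K with
  | nil => rw [probe, reveal_nil ι m M]; simp
  | cons a S ih =>
    rw [probe, queryCount, queryCount, ih, reveal_cons, List.length_cons]
    omega

open Classical in
/-- Query all columns and rows with indices in a list, and say "no" if there is no path of zeros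
that agrees with the replies. -/
noncomputable def verify (S : List ℕ) (K : (ℕ → ℕ → Prop) → QueryAlgorithm n) : QueryAlgorithm n :=
  probe ι m S fun V => if Consistent m V then K V else .answer false

/-- The indices at distance at most `h` from `y`. -/
def window (h y : ℕ) : List ℕ := (List.range m).filter fun x => y ≤ x + h ∧ x ≤ y + h

/-- Inspect one random window of each of the given radii. -/
noncomputable def sampleTest : List ℕ → QueryAlgorithm n → QueryAlgorithm n
  | [], K => K
  | h :: hs, K => drawIndex m fun y => verify ι m (window m h y) fun _ => sampleTest hs K

/-- Inspect the whole matrix. -/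
noncomputable def fullTest : QueryAlgorithm n := verify ι m (List.range m) fun _ => .answer true

/-- The index `y` together with the neighbouring multiples of powers of two. -/
def ancestors (y : ℕ) : List ℕ :=
  y :: (((List.range (Nat.log 2 m + 1)).map fun k => y / 2 ^ k * 2 ^ k) ++
    ((List.range (Nat.log 2 m + 1)).map fun k => (y / 2 ^ k + 1) * 2 ^ k)).filter fun a => a < m

/-- The zeros in column and row `y` are close to those in the columns and rows that are ancestors
of `y`. -/
def SlopeBounded (W : ℕ) (V : ℕ → ℕ → Prop) (y : ℕ) : Prop :=
  ∀ a ∈ ancestors m y, ∀ r r',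
    (V y r → V a r' → r' ≤ r + W * (1 + (y - a) + (a - y)) ∧ r ≤ r' + W * (1 + (y - a) + (a - y))) ∧
    (V r y → V r' a → r' ≤ r + W * (1 + (y - a) + (a - y)) ∧ r ≤ r' + W * (1 + (y - a) + (a - y)))

open Classical in
/-- The positions of the zeros in column and row `y`. -/
noncomputable def partners (V : ℕ → ℕ → Prop) (y : ℕ) : List ℕ :=
  (List.range m).filter fun r => V y r ∨ V r y

open Classical in
/-- Check the slope bound for `y` and for the positions of the zeros in column and row `y`;
continue with `next` if it fails and with `K` otherwise. -/
noncomputable def checkIndex (W y : ℕ) (next K : QueryAlgorithm n) : QueryAlgorithm n :=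
  verify ι m (ancestors m y) fun V =>
    if SlopeBounded m W V y then
      verify ι m ((partners m V y).flatMap (ancestors m)) fun V' =>
        if ∀ r ∈ partners m V y, SlopeBounded m W V' r then K else next
    else next

/-- Check the slope bound at `q` random indices. -/
noncomputable def slopeTest (W : ℕ) (next K : QueryAlgorithm n) : ℕ → QueryAlgorithm n
  | 0 => K
  | q + 1 => drawIndex m fun y => checkIndex ι m W y next (slopeTest W next K q)

/-- The window radii: about `A * L / 2 ^ k` windows of radius `2 ^ k`, for every `2 ^ k ≤ 4 * L`. -/
def scales (A L : ℕ) : List ℕ :=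
  (List.range (Nat.clog 2 (2 * L) + 1)).flatMap fun k => List.replicate (A * L / 2 ^ k + 1) (2 ^ k)

/-- The tester for a known locality. -/
noncomputable def knownTester (A L : ℕ) : QueryAlgorithm n :=
  if m ≤ L then fullTest ι m else
    verify ι m [0, m - 1] fun _ => sampleTest ι m (scales A L) (.answer true)

/-- The tester for an unknown locality, which passes to the next guess whenever it has seen
that the locality is worse than its current guess. -/
noncomputable def unknownTester (W A L : ℕ → ℕ) : ℕ → ℕ → QueryAlgorithm n
  | 0, _ => fullTest ι m
  | f + 1, j =>
    if m ≤ L j then fullTest ι m else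
      sampleTest ι m (scales (A j) (2 * L j)) <|
        checkIndex ι m (W j) 0 (unknownTester W A L f (j + 1)) <|
          checkIndex ι m (W j) (m - 1) (unknownTester W A L f (j + 1)) <|
            slopeTest ι m (W j) (unknownTester W A L f (j + 1)) (.answer true) (A j * L j)

variable {ι m} {M : Fin n → Fin n → ℕ}

open Classical in
lemma acc_verify (S : List ℕ) (K : (ℕ → ℕ → Prop) → QueryAlgorithm n) :
    acc M (verify ι m S K) = if Consistent m (reveal (zeroRel ι m M) m S) then
      acc M (K (reveal (zeroRel ι m M) m S)) else 0 := by
  rw [acc, verify, output_probe]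
  split_ifs with h
  · rfl
  · exact acc_false

lemma queryCount_verify_le {B : ℕ} (S : List ℕ) (K : (ℕ → ℕ → Prop) → QueryAlgorithm n)
    (h : (K (reveal (zeroRel ι m M) m S)).queryCount M ≤ B) :
    (verify ι m S K).queryCount M ≤ 2 * S.length + B := by
  rw [verify, queryCount_probe]
  split_ifs
  · omega
  · rw [queryCount]; omega

/-! ### Acceptance of close pairs -/

lemma acc_verify_eq_one (hc : Consistent m (zeroRel ι m M)) {S : List ℕ}
    {K : (ℕ → ℕ → Prop) → QueryAlgorithm n} (hK : ∀ V, acc M (K V) = 1) :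
    acc M (verify ι m S K) = 1 := by
  rw [acc_verify, if_pos (hc.reveal (zeroRel_lt ι m)), hK]

lemma acc_drawIndex_eq_one (hm : 0 < m) {next : ℕ → QueryAlgorithm n}
    (h : ∀ y, acc M (next y) = 1) : acc M (drawIndex m next) = 1 := by
  rw [acc_drawIndex hm, Finset.sum_congr rfl fun y _ => h y]
  have : (m : ℝ) ≠ 0 := by positivity
  simp [this]

lemma acc_sampleTest_eq_one (hm : 0 < m) (hc : Consistent m (zeroRel ι m M)) {K : QueryAlgorithm n}
    (hK : acc M K = 1) (hs : List ℕ) : acc M (sampleTest ι m hs K) = 1 := by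
  induction hs with
  | nil => exact hK
  | cons h hs ih => exact acc_drawIndex_eq_one hm fun y => acc_verify_eq_one hc fun _ => ih

lemma acc_checkIndex_eq_one (hc : Consistent m (zeroRel ι m M)) {next K : QueryAlgorithm n}
    (hn : acc M next = 1) (hK : acc M K = 1) (W y : ℕ) :
    acc M (checkIndex ι m W y next K) = 1 := by
  refine acc_verify_eq_one hc fun V => ?_
  split_ifs
  · refine acc_verify_eq_one hc fun V => ?_
    split_ifs <;> assumption
  · exact hn

lemma acc_slopeTest_eq_one (hm : 0 < m) (hc : Consistent m (zeroRel ι m M))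
    {next K : QueryAlgorithm n} (hn : acc M next = 1) (hK : acc M K = 1) (W q : ℕ) :
    acc M (slopeTest ι m W next K q) = 1 := by
  induction q with
  | zero => exact hK
  | succ q ih => exact acc_drawIndex_eq_one hm fun y => acc_checkIndex_eq_one hc hn ih W y

lemma acc_fullTest_eq_one (hc : Consistent m (zeroRel ι m M)) : acc M (fullTest ι m) = 1 :=
  acc_verify_eq_one hc fun _ => acc_true

lemma acc_knownTester_eq_one (hm : 0 < m) (hc : Consistent m (zeroRel ι m M)) (A L : ℕ) :
    acc M (knownTester ι m A L) = 1 := by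
  rw [knownTester]
  split_ifs
  · exact acc_fullTest_eq_one hc
  · exact acc_verify_eq_one hc fun _ => acc_sampleTest_eq_one hm hc acc_true _

lemma acc_unknownTester_eq_one (hm : 0 < m) (hc : Consistent m (zeroRel ι m M)) (W A L : ℕ → ℕ)
    (f j : ℕ) : acc M (unknownTester ι m W A L f j) = 1 := by
  induction f generalizing j with
  | zero => exact acc_fullTest_eq_one hc
  | succ f ih =>
    rw [unknownTester]
    split_ifs
    · exact acc_fullTest_eq_one hc
    · exact acc_sampleTest_eq_one hm hc (acc_checkIndex_eq_one hc (ih _)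
        (acc_checkIndex_eq_one hc (ih _) (acc_slopeTest_eq_one hm hc (ih _) acc_true _ _) _ _)
          _ _) _

end Algorithms

/-! ### Random windows -/

lemma two_pow_clog_le {y : ℕ} (hy : 1 ≤ y) : 2 ^ Nat.clog 2 y ≤ 2 * y := by
  rcases Nat.lt_or_ge 1 y with h | h
  · have h8 := Nat.pow_pred_clog_lt_self (b := 2) (by norm_num) h
    have h9 : 0 < Nat.clog 2 y := Nat.clog_pos (by norm_num) h
    obtain ⟨d, hd⟩ : ∃ d, Nat.clog 2 y = d + 1 := ⟨Nat.clog 2 y - 1, by omega⟩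
    rw [hd, Nat.pred_succ] at h8
    rw [hd, pow_succ]
    omega
  · obtain rfl : y = 1 := by omega
    simp

lemma sum_map_flatMap_replicate (g : ℕ → ℕ) (f : ℕ → ℕ) (κ : ℕ) :
    ((((List.range κ).flatMap fun k => List.replicate (g k) (2 ^ k)).map f).sum) =
      ∑ k ∈ Finset.range κ, g k * f (2 ^ k) := by
  induction κ with
  | zero => simp
  | succ κ ih =>
    rw [List.range_succ, List.flatMap_append, List.map_append, List.sum_append, ih,
      Finset.sum_range_succ]
    simp

/-- If there are many disjoint intervals then windows of random positions contain many of them. -/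
lemma le_sum_scales {m L A : ℕ} {T : Finset ℕ} {lo : ℕ → ℕ}
    (hlo : ∀ x ∈ T, lo x ≤ x) (hT : ∀ x ∈ T, x < m)
    (hdis : ∀ x ∈ T, ∀ x' ∈ T, x < x' → x < lo x') (hcard : m ≤ T.card * L)
    {C : ℕ → Finset ℕ} (hC : ∀ x ∈ T, ∀ h, x + 1 - lo x ≤ h → Finset.Icc (lo x) x ⊆ C h) :
    A * m ≤ 4 * ((scales A L).map fun h => (C h).card).sum := by
  have hpd : ∀ T' ⊆ T, Set.PairwiseDisjoint (T' : Set ℕ) fun x => Finset.Icc (lo x) x := by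
    intro T' hT' x hx x' hx' hne
    refine Finset.disjoint_left.2 fun y hy hy' => ?_
    rw [Finset.mem_Icc] at hy hy'
    rcases lt_or_gt_of_ne hne with h | h
    · have := hdis x (hT' hx) x' (hT' hx') h; omega
    · have := hdis x' (hT' hx') x (hT' hx) h; omega
  have hsum : ∀ T' ⊆ T, ∀ D : Finset ℕ, (∀ x ∈ T', Finset.Icc (lo x) x ⊆ D) →
      ∑ x ∈ T', (x + 1 - lo x) ≤ D.card := by
    intro T' hT' D hD
    rw [← Finset.sum_congr rfl fun x _ => Nat.card_Icc (lo x) x, ← Finset.card_biUnion (hpd T' hT')]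
    exact Finset.card_le_card (Finset.biUnion_subset.2 hD)
  set Ts := T.filter fun x => x + 1 - lo x ≤ 2 * L with hTs
  -- Disjoint intervals longer than `2 * L` number at most `m / (2 * L)`, so at least `m / (2 * L)`
  -- short ones remain.
  have h1 : m ≤ 2 * L * Ts.card := by
    have h2 := Finset.card_filter_add_card_filter_not (s := T) fun x => x + 1 - lo x ≤ 2 * L
    have h3 : (T.filter fun x => ¬ x + 1 - lo x ≤ 2 * L).card * (2 * L) ≤ m := by
      rw [← smul_eq_mul, ← Finset.sum_const]
      calc _ ≤ ∑ x ∈ T.filter fun x => ¬ x + 1 - lo x ≤ 2 * L, (x + 1 - lo x) :=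
            Finset.sum_le_sum fun x hx => by
              have := (Finset.mem_filter.1 hx).2
              omega
        _ ≤ (Finset.range m).card := hsum _ (Finset.filter_subset _ _) _ fun x hx y hy => by
            have := hT x (Finset.mem_filter.1 hx).1
            rw [Finset.mem_Icc] at hy
            exact Finset.mem_range.2 (by omega)
        _ = m := Finset.card_range m
    rw [← h2] at hcard
    rw [← hTs] at hcard
    nlinarith
  rw [scales, sum_map_flatMap_replicate]
  have h2 : ∀ k, ∑ x ∈ Ts, (if x + 1 - lo x ≤ 2 ^ k then x + 1 - lo x else 0) ≤ (C (2 ^ k)).card := by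
    intro k
    rw [← Finset.sum_filter]
    refine hsum _ ((Finset.filter_subset _ _).trans (Finset.filter_subset _ _)) _ fun x hx => ?_
    rw [Finset.mem_filter, Finset.mem_filter] at hx
    exact hC x hx.1.1 _ hx.2
  have h3 : A * L * Ts.card ≤ 2 * ∑ k ∈ Finset.range (Nat.clog 2 (2 * L) + 1),
      (A * L / 2 ^ k + 1) * (C (2 ^ k)).card := by
    calc A * L * Ts.card = ∑ x ∈ Ts, A * L := by simp [mul_comm]
      _ ≤ ∑ x ∈ Ts, 2 * ∑ k ∈ Finset.range (Nat.clog 2 (2 * L) + 1),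
          (A * L / 2 ^ k + 1) * (if x + 1 - lo x ≤ 2 ^ k then x + 1 - lo x else 0) := by
        refine Finset.sum_le_sum fun x hx => ?_
        have hx' := Finset.mem_filter.1 hx
        have hlx := hlo x hx'.1
        set l := x + 1 - lo x with hl
        -- An interval of length `l` is charged to the scale `2 ^ k` with `l ≤ 2 ^ k ≤ 2 * l`; there
        -- the number of windows times `l` is at least `A * L / 2`.
        have hk : Nat.clog 2 l < Nat.clog 2 (2 * L) + 1 :=
          Nat.lt_succ_of_le (Nat.clog_mono_right 2 hx'.2)
        have h5 := Finset.single_le_sum (f := fun k => (A * L / 2 ^ k + 1) *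
          (if l ≤ 2 ^ k then l else 0)) (fun _ _ => Nat.zero_le _) (Finset.mem_range.2 hk)
        have h6 : l ≤ 2 ^ Nat.clog 2 l := Nat.le_pow_clog (by norm_num) l
        have h7 := two_pow_clog_le (show 1 ≤ l by omega)
        simp only [if_pos h6] at h5
        have h8 := Nat.lt_mul_div_succ (A * L) (show 0 < 2 ^ Nat.clog 2 l by positivity)
        calc A * L ≤ 2 ^ Nat.clog 2 l * (A * L / 2 ^ Nat.clog 2 l + 1) := h8.le
          _ ≤ 2 * l * (A * L / 2 ^ Nat.clog 2 l + 1) := Nat.mul_le_mul_right _ h7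
          _ = 2 * ((A * L / 2 ^ Nat.clog 2 l + 1) * l) := by ring
          _ ≤ _ := Nat.mul_le_mul_left _ h5
      _ = 2 * ∑ k ∈ Finset.range (Nat.clog 2 (2 * L) + 1), (A * L / 2 ^ k + 1) *
          ∑ x ∈ Ts, (if x + 1 - lo x ≤ 2 ^ k then x + 1 - lo x else 0) := by
        rw [← Finset.mul_sum, Finset.sum_comm]
        simp only [Finset.mul_sum]
      _ ≤ _ := Nat.mul_le_mul_left _ (Finset.sum_le_sum fun k _ => Nat.mul_le_mul_left _ (h2 k))
  calc A * m ≤ A * (2 * L * Ts.card) := Nat.mul_le_mul_left _ h1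
    _ = 2 * (A * L * Ts.card) := by ring
    _ ≤ 2 * (2 * _) := Nat.mul_le_mul_left _ h3
    _ = _ := by ring

section Rejection

variable {n : ℕ} {ι : ℕ → Fin n} {m : ℕ} {M : Fin n → Fin n → ℕ}

open Classical in
/-- The centres of the windows of radius `h` that contradict the existence of a path of zeros. -/
noncomputable def caught (Z : ℕ → ℕ → Prop) (m h : ℕ) : Finset ℕ :=
  (Finset.range m).filter fun y => ¬ Consistent m (reveal Z m (window m h y))

lemma mem_caught {Z : ℕ → ℕ → Prop} {h y : ℕ} :
    y ∈ caught Z m h ↔ y < m ∧ ¬ Consistent m (reveal Z m (window m h y)) := by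
  simp [caught]

open Classical in
lemma sum_range_ite_le (p : ℕ → Prop) (hm : 0 < m) {a b : ℝ} (hb : 0 ≤ b)
    (f : ℕ → ℝ) (hf : ∀ y < m, f y ≤ a + if p y then 0 else b) :
    (∑ y ∈ Finset.range m, f y) / m ≤
      a + Real.exp (-(((Finset.range m).filter p).card / m : ℝ)) * b := by
  have hm' : (0 : ℝ) < m := by exact_mod_cast hm
  have h1 : ∑ y ∈ Finset.range m, f y ≤ ∑ y ∈ Finset.range m, (a + if p y then 0 else b) :=
    Finset.sum_le_sum fun y hy => hf y (Finset.mem_range.1 hy)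
  have h2 : ∑ y ∈ Finset.range m, (a + if p y then 0 else b) =
      m * a + (m - ((Finset.range m).filter p).card) * b := by
    have h3 := Finset.card_filter_add_card_filter_not (s := Finset.range m) p
    rw [Finset.card_range] at h3
    have h4 : ((((Finset.range m).filter p).card : ℝ)) +
      ((Finset.range m).filter fun y => ¬ p y).card = m := by exact_mod_cast h3
    have h5 : ∑ y ∈ Finset.range m, (if p y then 0 else b) =
        ((Finset.range m).filter fun y => ¬ p y).card * b := by
      rw [Finset.sum_ite]; simp
    rw [Finset.sum_add_distrib, h5, Finset.sum_const, Finset.card_range, nsmul_eq_mul]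
    congr 2
    linarith
  have h3 := Real.add_one_le_exp (-(((Finset.range m).filter p).card / m : ℝ))
  calc _ ≤ (m * a + (m - ((Finset.range m).filter p).card) * b) / m := by
        rw [← h2]; gcongr
    _ = a + (-(((Finset.range m).filter p).card / m : ℝ) + 1) * b := by field_simp; ring
    _ ≤ _ := by gcongr

/-- The windows are independent, and each factor `1 - p` is at most `exp (-p)`. -/
lemma acc_sampleTest_le (hm : 0 < m) (hs : List ℕ) (K : QueryAlgorithm n) :
    acc M (sampleTest ι m hs K) ≤
      Real.exp (-(((hs.map fun h => (caught (zeroRel ι m M) m h).card).sum : ℕ) / m : ℝ)) *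
        acc M K := by
  classical
  induction hs with
  | nil => simp [sampleTest]
  | cons h hs ih =>
    rw [sampleTest, acc_drawIndex hm]
    refine (sum_range_ite_le (fun y => ¬ Consistent m (reveal (zeroRel ι m M) m (window m h y)))
      hm (a := 0) (b := acc M (sampleTest ι m hs K)) (acc_nonneg _) _ fun y _ => ?_).trans ?_
    · rw [acc_verify, zero_add]
      split_ifs <;> simp_all
    · rw [zero_add, List.map_cons, List.sum_cons, Nat.cast_add, add_div, neg_add, Real.exp_add,
        mul_assoc]
      refine mul_le_mul (le_of_eq ?_) ih (acc_nonneg _) (Real.exp_nonneg _)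
      unfold caught
      congr!

/-- Disjoint intervals that no path of zeros traverses. -/
lemma acc_sampleTest_scales_le (hm : 0 < m) {A L : ℕ} {T : Finset ℕ} {lo : ℕ → ℕ}
    (hlo : ∀ x ∈ T, lo x ≤ x) (hT : ∀ x ∈ T, x + 1 < m)
    (hdis : ∀ x ∈ T, ∀ x' ∈ T, x < x' → x < lo x') (hcard : m ≤ T.card * L)
    (hbad : ∀ x ∈ T, ¬ Crossable (zeroRel ι m M) (lo x) (x + 1) ∨
      ¬ Crossable (transp (zeroRel ι m M)) (lo x) (x + 1)) (K : QueryAlgorithm n) :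
    acc M (sampleTest ι m (scales A L) K) ≤ Real.exp (-(A / 4 : ℝ)) * acc M K := by
  refine (acc_sampleTest_le hm _ K).trans ?_
  have hC : ∀ x ∈ T, ∀ h, x + 1 - lo x ≤ h →
      Finset.Icc (lo x) x ⊆ caught (zeroRel ι m M) m h := by
    intro x hx h hh y hy
    rw [Finset.mem_Icc] at hy
    have hxm := hT x hx
    refine mem_caught.2 ⟨by omega, fun hcon => ?_⟩
    have hwin : ∀ i, lo x ≤ i → i ≤ x + 1 → i ∈ window m h y := by
      intro i h1 h2
      simp only [window, List.mem_filter, List.mem_range, decide_eq_true_eq]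
      omega
    have hle := hlo x hx
    rcases hbad x hx with hb | hb
    · exact hb (hcon.crossable (by omega) hxm hwin)
    · exact hb (hcon.transp.crossable (by omega) hxm hwin)
  have key := le_sum_scales (A := A) hlo (fun x hx => by have := hT x hx; omega) hdis hcard hC
  refine mul_le_mul_of_nonneg_right (Real.exp_le_exp.2 (neg_le_neg ?_)) (acc_nonneg _)
  have hm' : (0 : ℝ) < m := by exact_mod_cast hm
  rw [div_le_div_iff₀ (by norm_num) hm']
  have : ((A * m : ℕ) : ℝ) ≤ ((4 * ((scales A L).map fun h =>
    (caught (zeroRel ι m M) m h).card).sum : ℕ) : ℝ) := by exact_mod_cast key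
  push_cast at this ⊢
  linarith

/-! ### Many breaks in far pairs -/

/-- A new piece starts at `x + 1`, and `pieceStart` is monotone. -/
lemma breaks_disjoint {Z : ℕ → ℕ → Prop} {x x' : ℕ}
    (hx : ¬ Crossable Z (pieceStart Z x) (x + 1)) (h : x < x') : x < pieceStart Z x' := by
  have h1 : pieceStart Z (x + 1) = x + 1 := by rw [pieceStart, if_neg hx]
  have h2 := pieceStart_mono Z (show x + 1 ≤ x' by omega)
  omega

/-- If both break numbers `b`, `b'` were below `m / L`, the path of `cReach_of_breaks` would have `2
* k = 20 * W * (b + b') + 44 * W`, and `88 * W ≤ ε * L` makes each summand less than `ε * m / 2`.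
The smaller relation `Z'` allows zeros that violate locality to be discarded first. -/
lemma many_breaks {Z Z' : ℕ → ℕ → Prop} {W L : ℕ} {ε : ℝ} (hε : 0 < ε) (hZ : ∀ i j, Z' i j → Z i j)
    (hL : Local Z' m W) (h0 : Z' 0 0) (hend : Z' (m - 1) (m - 1)) (hWL : 88 * (W : ℝ) ≤ ε * L)
    (hLm : L < m) (hfar : ∀ k : ℕ, CReach Z k (0, 0) (m - 1, m - 1) → ε * m < 2 * k) :
    m ≤ (breaks Z' (m - 1)).card * L ∨ m ≤ (breaks (transp Z') (m - 1)).card * L := by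
  by_contra! hcon
  have h1 := hfar _ ((cReach_of_breaks hL h0 hend).mono_set hZ)
  set b := (breaks Z' (m - 1)).card
  set b' := (breaks (transp Z') (m - 1)).card
  have h2 : (b : ℝ) * L < m := by exact_mod_cast hcon.1
  have h3 : (b' : ℝ) * L < m := by exact_mod_cast hcon.2
  have h4 : (L : ℝ) < m := by exact_mod_cast hLm
  push_cast at h1
  have h5 : ε * L < ε * m := by gcongr
  have h6 : ε * ((b + b') * L) ≤ ε * (2 * m) := 
    mul_le_mul_of_nonneg_left (by rw [add_mul]; linarith) hε.le
  have h7 : 88 * (W : ℝ) * (b + b') ≤ ε * L * (b + b') := by gcongr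
  have h8 : (0 : ℝ) ≤ W * (b + b') := by positivity
  nlinarith

lemma acc_fullTest_eq_zero {ε : ℝ}
    (hfar : zeroRel ι m M 0 0 → zeroRel ι m M (m - 1) (m - 1) → ∀ k : ℕ,
      CReach (zeroRel ι m M) k (0, 0) (m - 1, m - 1) → ε * m < 2 * k) (hε : 0 < ε) :
    acc M (fullTest ι m) = 0 := by
  classical
  rw [fullTest, acc_verify, if_neg]
  intro hc
  have h : Consistent m (zeroRel ι m M) :=
    hc.mono fun i j h => h.2.2 (Or.inl (List.mem_range.2 h.1))
  have := hfar h.1 (ZPath.right h) 0 (ZPath.cReach h)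
  have : 0 ≤ ε * m := by positivity
  norm_num at *
  linarith

/-- A far pair with known locality is recognized. -/
lemma acc_knownTester_le (hm : 0 < m) {W L A : ℕ} {ε : ℝ} (hε : 0 < ε)
    (hloc : Local (zeroRel ι m M) m W) (hWL : 88 * (W : ℝ) ≤ ε * L)
    (hfar : zeroRel ι m M 0 0 → zeroRel ι m M (m - 1) (m - 1) → ∀ k : ℕ,
      CReach (zeroRel ι m M) k (0, 0) (m - 1, m - 1) → ε * m < 2 * k) :
    acc M (knownTester ι m A L) ≤ Real.exp (-(A / 4 : ℝ)) := by
  classical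
  rw [knownTester]
  split_ifs with hmL
  · exact (acc_fullTest_eq_zero hfar hε).trans_le (Real.exp_nonneg _)
  · rw [acc_verify]
    split_ifs with hc
    · obtain ⟨h0, h1⟩ := hc.corners (by simp) (by simp)
      have key : ∀ Y : ℕ → ℕ → Prop, (Y = zeroRel ι m M ∨ Y = transp (zeroRel ι m M)) →
          m ≤ (breaks Y (m - 1)).card * L →
          acc M (sampleTest ι m (scales A L) (.answer true)) ≤ Real.exp (-(A / 4 : ℝ)) := by
        intro Y hY hcard
        have := acc_sampleTest_scales_le (M := M) (ι := ι) (A := A) hm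
          (T := breaks Y (m - 1)) (lo := pieceStart Y) (fun x _ => pieceStart_le Y x)
          (fun x hx => by have := (mem_breaks.1 hx).1; omega)
          (fun x hx x' _ h => breaks_disjoint (mem_breaks.1 hx).2 h) hcard
          (fun x hx => by
            have := (mem_breaks.1 hx).2
            rcases hY with rfl | rfl
            · exact Or.inl this
            · exact Or.inr this) (.answer true)
        simpa using this
      rcases many_breaks hε (fun _ _ h => h) hloc h0 h1 hWL (by omega) (hfar h0 h1) with h | h
      · exact key _ (Or.inl rfl) h
      · exact key _ (Or.inr rfl) h
    · positivity

end Rejection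

/-! ### Checking the slope bound at random indices -/

lemma self_mem_ancestors (m y : ℕ) : y ∈ ancestors m y := List.mem_cons_self

/-- Two indices have a common ancestor between them. -/
lemma exists_common_ancestor {m c c' : ℕ} (h : c < c') (hm : c' < m) :
    ∃ a, c ≤ a ∧ a ≤ c' ∧ a ∈ ancestors m c ∧ a ∈ ancestors m c' := by
  classical
  set P : ℕ → Prop := fun k => c / 2 ^ k ≠ c' / 2 ^ k with hP
  -- At the coarsest level separating `c` from `c'` their dyadic blocks are siblings. The boundary
  -- between these blocks is an ancestor of both indices.
  set k := Nat.findGreatest P (Nat.log 2 m) with hk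
  have hk1 : k ≤ Nat.log 2 m := Nat.findGreatest_le _
  have hPk : P k := Nat.findGreatest_spec (m := 0) (Nat.zero_le _) (by simp [hP]; omega)
  have hPk1 : c / 2 ^ (k + 1) = c' / 2 ^ (k + 1) := by
    rcases hk1.eq_or_lt with he | hlt
    · have : m < 2 ^ (k + 1) := he ▸ Nat.lt_pow_succ_log_self (by norm_num) m
      rw [Nat.div_eq_of_lt (by omega), Nat.div_eq_of_lt (by omega)]
    · by_contra hcon
      exact Nat.findGreatest_is_greatest (Nat.lt_succ_self k) hlt hcon
  rw [pow_succ, ← Nat.div_div_eq_div_mul, ← Nat.div_div_eq_div_mul] at hPk1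
  have hle : c / 2 ^ k ≤ c' / 2 ^ k := Nat.div_le_div_right h.le
  have hPk' : c / 2 ^ k ≠ c' / 2 ^ k := hPk
  have heq : c' / 2 ^ k = c / 2 ^ k + 1 := by omega
  have h1 : c' / 2 ^ k * 2 ^ k ≤ c' := Nat.div_mul_le_self _ _
  have h2 : c < (c / 2 ^ k + 1) * 2 ^ k := by
    have := Nat.lt_mul_div_succ c (show 0 < 2 ^ k by positivity)
    rwa [mul_comm]
  refine ⟨c' / 2 ^ k * 2 ^ k, by rw [heq]; omega, h1, ?_, ?_⟩
  · refine List.mem_cons_of_mem _ (List.mem_filter.2 ⟨List.mem_append_right _ ?_, ?_⟩)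
    · exact List.mem_map.2 ⟨k, List.mem_range.2 (by omega), by rw [heq]⟩
    · simp only [decide_eq_true_eq]; omega
  · refine List.mem_cons_of_mem _ (List.mem_filter.2 ⟨List.mem_append_left _ ?_, ?_⟩)
    · exact List.mem_map.2 ⟨k, List.mem_range.2 (by omega), rfl⟩
    · simp only [decide_eq_true_eq]; omega

lemma length_ancestors_le (m y : ℕ) : (ancestors m y).length ≤ 2 * Nat.log 2 m + 3 := by
  rw [ancestors, List.length_cons]
  have := List.length_filter_le (fun a => decide (a < m))
    (((List.range (Nat.log 2 m + 1)).map fun k => y / 2 ^ k * 2 ^ k) ++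
    ((List.range (Nat.log 2 m + 1)).map fun k => (y / 2 ^ k + 1) * 2 ^ k))
  simp only [List.length_append, List.length_map, List.length_range] at this
  omega

section Slope

variable {Z : ℕ → ℕ → Prop} {m W : ℕ}

/-- The ancestors of `y` reveal neither a contradiction nor a violation of the slope bound. -/
def Steady (Z : ℕ → ℕ → Prop) (m W y : ℕ) : Prop :=
  Consistent m (reveal Z m (ancestors m y)) ∧ SlopeBounded m W Z y

/-- The index `y` and the positions of the zeros in column and row `y` are steady. -/
def VerySteady (Z : ℕ → ℕ → Prop) (m W y : ℕ) : Prop :=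
  Steady Z m W y ∧ ∀ r, Z y r ∨ Z r y → Steady Z m W r

lemma slopeBounded_reveal (hZ : ∀ {i j}, Z i j → i < m ∧ j < m) {S : List ℕ} {y : ℕ}
    (hS : ancestors m y ⊆ S) : SlopeBounded m W (reveal Z m S) y ↔ SlopeBounded m W Z y := by
  have hy := hS (self_mem_ancestors m y)
  refine forall₂_congr fun a ha => forall₂_congr fun r r' => ?_
  rw [reveal_column hZ hy, reveal_column hZ (hS ha), reveal_row hZ hy, reveal_row hZ (hS ha)]

lemma SlopeBounded.transp {y : ℕ} (h : SlopeBounded m W Z y) :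
    SlopeBounded m W (transp Z) y := fun a ha r r' => (h a ha r r').symm

lemma Steady.transp {y : ℕ} (h : Steady Z m W y) : Steady (transp Z) m W y :=
  ⟨h.1.transp, h.2.transp⟩

lemma Local.slopeBounded (h : Local Z m W) (y : ℕ) : SlopeBounded m W Z y := by
  refine fun a _ r r' => ⟨fun h1 h2 => ⟨h.col h1 h2, ?_⟩, fun h1 h2 => ⟨h.row h1 h2, ?_⟩⟩
  · have := h.col h2 h1
    rwa [add_right_comm] at this
  · have := h.row h2 h1
    rwa [add_right_comm] at this

/-- Compare both zeros with a zero in the column of a common ancestor `a` between `c` and `c'`.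
Consistency guarantees that this column is not empty, and the two slope bounds add up to the factor
`2`. -/
lemma steady_column_le {c r c' r' : ℕ} (hZ : ∀ {i j}, Z i j → i < m ∧ j < m)
    (h : Z c r) (h' : Z c' r') (hc : Steady Z m W c) (hc' : Steady Z m W c') :
    r' ≤ r + 2 * W * (1 + (c - c') + (c' - c)) := by
  have hcm := (hZ h).1
  have hcm' := (hZ h').1
  rcases lt_trichotomy c c' with hlt | rfl | hlt
  · obtain ⟨a, h1, h2, h3, h4⟩ := exists_common_ancestor hlt hcm'
    obtain ⟨ρ, hρ⟩ := hc.1.exists_column h3 (by omega)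
    have e1 := ((hc.2 a h3 r ρ).1 h hρ).1
    have e2 := ((hc'.2 a h4 r' ρ).1 h' hρ).2
    have e3 : W * (1 + (c - a) + (a - c)) + W * (1 + (c' - a) + (a - c')) ≤
        W * (2 * (1 + (c - c') + (c' - c))) := by
      rw [← Nat.mul_add]; exact Nat.mul_le_mul_left _ (by omega)
    have e4 : 2 * W * (1 + (c - c') + (c' - c)) = W * (2 * (1 + (c - c') + (c' - c))) := by ring
    omega
  · have e1 := ((hc.2 c (self_mem_ancestors m c) r r').1 h h').1
    rw [Nat.sub_self] at *
    omega
  · obtain ⟨a, h1, h2, h3, h4⟩ := exists_common_ancestor hlt hcm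
    obtain ⟨ρ, hρ⟩ := hc.1.exists_column h4 (by omega)
    have e1 := ((hc.2 a h4 r ρ).1 h hρ).1
    have e2 := ((hc'.2 a h3 r' ρ).1 h' hρ).2
    have e3 : W * (1 + (c - a) + (a - c)) + W * (1 + (c' - a) + (a - c')) ≤
        W * (2 * (1 + (c - c') + (c' - c))) := by
      rw [← Nat.mul_add]; exact Nat.mul_le_mul_left _ (by omega)
    have e4 : 2 * W * (1 + (c - c') + (c' - c)) = W * (2 * (1 + (c - c') + (c' - c))) := by ring
    omega

lemma local_steady (hZ : ∀ {i j}, Z i j → i < m ∧ j < m) :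
    Local (fun i j => Z i j ∧ Steady Z m W i ∧ Steady Z m W j) m (2 * W) where
  lt h := hZ h.1
  col h h' := steady_column_le hZ h.1 h'.1 h.2.1 h'.2.1
  row h h' := steady_column_le (Z := transp Z) (fun h => (hZ h).symm) h.1 h'.1 h.2.2.transp
    h'.2.2.transp

/-- Here `VerySteady` is needed: the rows that the path visits are positions of zeros in very steady
columns, so they are steady too. -/
lemma Crossable.steady {a b : ℕ} (h : Crossable Z a b)
    (hs : ∀ x, a ≤ x → x ≤ b → VerySteady Z m W x) :
    Crossable (fun i j => Z i j ∧ Steady Z m W i ∧ Steady Z m W j) a b :=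
  h.mono fun x y h1 h2 h3 => ⟨h3, (hs x h1 h2).1, (hs x h1 h2).2 y (Or.inl h3)⟩

lemma VerySteady.transp {y : ℕ} (h : VerySteady Z m W y) :
    VerySteady (FrechetTesting.transp Z) m W y :=
  ⟨h.1.transp, fun r hr => (h.2 r hr.symm).transp⟩

/-- Few exceptional indices spoil few of the intervals between breaks. -/
lemma card_breaks_le_filter (Y : ℕ → ℕ → Prop) (k : ℕ) (bad : Finset ℕ) :
    (breaks Y k).card ≤ ((breaks Y k).filter fun x =>
      ∀ y ∈ bad, ¬ (pieceStart Y x ≤ y ∧ y ≤ x + 1)).card + 2 * bad.card := by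
  classical
  have h1 := Finset.card_filter_add_card_filter_not (s := breaks Y k)
    fun x => ∀ y ∈ bad, ¬ (pieceStart Y x ≤ y ∧ y ≤ x + 1)
  set D := (breaks Y k).filter fun x => ¬ ∀ y ∈ bad, ¬ (pieceStart Y x ≤ y ∧ y ≤ x + 1) with hD
  -- The intervals overlap in at most their right ends `x + 1`. So an exceptional index spoils at
  -- most one interval as its right end and at most one otherwise.
  have h2 : D ⊆ (D.filter fun x => x + 1 ∈ bad) ∪
      D.filter fun x => ∃ y ∈ bad, pieceStart Y x ≤ y ∧ y ≤ x := by
    intro x hx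
    have hx' := (Finset.mem_filter.1 hx).2
    push Not at hx'
    obtain ⟨y, hy, hy1, hy2⟩ := hx'
    rw [Finset.mem_union, Finset.mem_filter (s := D), Finset.mem_filter (s := D)]
    rcases hy2.eq_or_lt with rfl | hlt
    · exact Or.inl ⟨hx, hy⟩
    · exact Or.inr ⟨hx, y, hy, hy1, by omega⟩
  have h3 : (D.filter fun x => x + 1 ∈ bad).card ≤ bad.card :=
    Finset.card_le_card_of_injOn (fun x => x + 1) (fun x hx => (Finset.mem_filter.1 hx).2)
      fun x _ x' _ h => by simpa using h
  have h4 : (D.filter fun x => ∃ y ∈ bad, pieceStart Y x ≤ y ∧ y ≤ x).card ≤ bad.card := by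
    refine Finset.card_le_card_of_forall_subsingleton
      (fun x y => pieceStart Y x ≤ y ∧ y ≤ x) (fun x hx => (Finset.mem_filter.1 hx).2) ?_
    rintro y - x ⟨hx, hx1, hx2⟩ x' ⟨hx', hx1', hx2'⟩
    have hb : ∀ x ∈ D.filter fun x => ∃ y ∈ bad, pieceStart Y x ≤ y ∧ y ≤ x,
        ¬ Crossable Y (pieceStart Y x) (x + 1) := fun x hx =>
      (mem_breaks.1 (Finset.mem_filter.1 (Finset.mem_filter.1 hx).1).1).2
    rcases lt_trichotomy x x' with h | h | h
    · have := breaks_disjoint (hb x hx) h; omega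
    · exact h
    · have := breaks_disjoint (hb x' hx') h; omega
  have h5 := (Finset.card_le_card h2).trans (Finset.card_union_le _ _)
  omega

end Slope

/-! ### Error probability of the tester for an unknown locality. -/

section Unknown

variable {n : ℕ} {ι : ℕ → Fin n} {m : ℕ} {M : Fin n → Fin n → ℕ}

-- An index that is not very steady leads either to "no", or to `next`.
open Classical in
lemma acc_checkIndex_le (W y : ℕ) (next K : QueryAlgorithm n) :
    acc M (checkIndex ι m W y next K) ≤
      if VerySteady (zeroRel ι m M) m W y then acc M K else acc M next := by
  have hZ : ∀ {i j}, zeroRel ι m M i j → i < m ∧ j < m := zeroRel_lt ι m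
  set Z := zeroRel ι m M with hZdef
  have hpos : 0 ≤ if VerySteady Z m W y then acc M K else acc M next := by
    split_ifs <;> exact acc_nonneg _
  rw [checkIndex, acc_verify, ← hZdef]
  by_cases hc : Consistent m (reveal Z m (ancestors m y))
  swap
  · rwa [if_neg hc]
  rw [if_pos hc]
  have hslope := slopeBounded_reveal (W := W) hZ (List.Subset.refl (ancestors m y))
  by_cases hs : SlopeBounded m W Z y
  swap
  · rw [if_neg (hslope.not.2 hs), if_neg fun h => hs h.1.2]
  rw [if_pos (hslope.2 hs), acc_verify, ← hZdef]
  set R := partners m (reveal Z m (ancestors m y)) y with hR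
  have hmem : ∀ r, Z y r ∨ Z r y → r ∈ R := by
    intro r hr
    rw [hR, partners, List.mem_filter, List.mem_range, decide_eq_true_eq,
      reveal_column hZ (self_mem_ancestors m y), reveal_row hZ (self_mem_ancestors m y)]
    exact ⟨hr.elim (fun h => (hZ h).2) fun h => (hZ h).1, hr⟩
  have hsub : ∀ r ∈ R, ancestors m r ⊆ R.flatMap (ancestors m) := fun r hr a ha =>
    List.mem_flatMap.2 ⟨r, hr, ha⟩
  split_ifs with h1 h2 h3 h3
  · exact le_rfl
  · refine absurd ⟨⟨hc, hs⟩, fun r hr => ?_⟩ h3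
    have hr' := hmem r hr
    exact ⟨h1.of_subset (hsub r hr'), (slopeBounded_reveal hZ (hsub r hr')).1 (h2 r hr')⟩
  · refine absurd (fun r hr => ?_) h2
    refine (slopeBounded_reveal hZ (hsub r hr)).2 (h3.2 r ?_).2
    rw [hR, partners, List.mem_filter, List.mem_range, decide_eq_true_eq,
      reveal_column hZ (self_mem_ancestors m y), reveal_row hZ (self_mem_ancestors m y)] at hr
    exact hr.2
  · exact le_rfl
  · exact acc_nonneg _
  · exact acc_nonneg _

open Classical in
/-- The indices that are not very steady. -/
noncomputable def unsteady (Z : ℕ → ℕ → Prop) (m W : ℕ) : Finset ℕ :=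
  (Finset.range m).filter fun y => ¬ VerySteady Z m W y

lemma acc_slopeTest_le (hm : 0 < m) (W : ℕ) (next K : QueryAlgorithm n) (q : ℕ) :
    acc M (slopeTest ι m W next K q) ≤ acc M next +
      Real.exp (-(q * ((unsteady (zeroRel ι m M) m W).card / m) : ℝ)) * acc M K := by
  classical
  induction q with
  | zero => simpa [slopeTest] using acc_nonneg _
  | succ q ih =>
    rw [slopeTest, acc_drawIndex hm]
    refine (sum_range_ite_le (fun y => ¬ VerySteady (zeroRel ι m M) m W y) hm (a := acc M next)
      (b := Real.exp (-(q * ((unsteady (zeroRel ι m M) m W).card / m) : ℝ)) * acc M K)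
      (mul_nonneg (Real.exp_nonneg _) (acc_nonneg _)) _ fun y _ => ?_).trans ?_
    · refine (acc_checkIndex_le W y next _).trans ?_
      split_ifs
      · exact ih
      · simp
    · rw [← mul_assoc, ← Real.exp_add]
      refine le_of_eq ?_
      have hu : ∀ i : DecidablePred fun y => ¬ VerySteady (zeroRel ι m M) m W y,
          @Finset.filter ℕ _ i (Finset.range m) = unsteady (zeroRel ι m M) m W := by
        intro i
        unfold unsteady
        congr!
      rw [hu]
      congr 3
      push_cast
      ring

/-- A single round of the tester for an unknown locality. -/
lemma acc_round_le (hm : 0 < m) {W L A : ℕ} {ε : ℝ} (hε : 0 < ε) (hWL : 176 * (W : ℝ) ≤ ε * L)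
    (hLm : L < m)
    (hfar : zeroRel ι m M 0 0 → zeroRel ι m M (m - 1) (m - 1) → ∀ k : ℕ,
      CReach (zeroRel ι m M) k (0, 0) (m - 1, m - 1) → ε * m < 2 * k) (next : QueryAlgorithm n) :
    acc M (sampleTest ι m (scales A (2 * L)) <| checkIndex ι m W 0 next <|
      checkIndex ι m W (m - 1) next <| slopeTest ι m W next (.answer true) (A * L)) ≤
      acc M next + Real.exp (-(A / 4 : ℝ)) := by
  classical
  have hZ : ∀ {i j}, zeroRel ι m M i j → i < m ∧ j < m := zeroRel_lt ι m
  set K := checkIndex ι m W 0 next <|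
      checkIndex ι m W (m - 1) next <| slopeTest ι m W next (.answer true) (A * L) with hK
  have hexp := Real.exp_nonneg (-(A / 4 : ℝ))
  have hK0 := acc_nonneg (M := M) K
  have hn0 := acc_nonneg (M := M) next
  have hm' : (0 : ℝ) < m := by exact_mod_cast hm
  have hdrop : acc M (sampleTest ι m (scales A (2 * L)) K) ≤ acc M K := by
    refine (acc_sampleTest_le hm _ _).trans (mul_le_of_le_one_left hK0 (Real.exp_le_one_iff.2 ?_))
    rw [neg_nonpos]
    positivity
  have hKle := acc_checkIndex_le (M := M) (ι := ι) (m := m) W 0 next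
    (checkIndex ι m W (m - 1) next <| slopeTest ι m W next (.answer true) (A * L))
  have hKle' := acc_checkIndex_le (M := M) (ι := ι) (m := m) W (m - 1) next
    (slopeTest ι m W next (.answer true) (A * L))
  rw [← hK] at hKle
  -- Both corners must be very steady in order to survive when unsteady zeros are discarded.
  -- Otherwise the round accepts no more often than `next`.
  by_cases hv0 : VerySteady (zeroRel ι m M) m W 0
  swap
  · rw [if_neg hv0] at hKle
    linarith
  by_cases hv1 : VerySteady (zeroRel ι m M) m W (m - 1)
  swap
  · rw [if_pos hv0] at hKle
    rw [if_neg hv1] at hKle'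
    linarith
  rw [if_pos hv0] at hKle
  rw [if_pos hv1] at hKle'
  -- With at least `m / (4 * L)` unsteady indices the `A * L` samples of the slope test find one.
  -- With fewer, at most half of the breaks are spoiled and the random windows succeed.
  by_cases hbad : m ≤ 4 * L * (unsteady (zeroRel ι m M) m W).card
  · have h1 := acc_slopeTest_le (M := M) (ι := ι) hm W next (.answer true) (A * L)
    have h2 : Real.exp (-((A * L : ℕ) * ((unsteady (zeroRel ι m M) m W).card / m) : ℝ)) ≤
        Real.exp (-(A / 4 : ℝ)) := by
      refine Real.exp_le_exp.2 (neg_le_neg ?_)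
      have h3 : (m : ℝ) ≤ 4 * L * (unsteady (zeroRel ι m M) m W).card := by exact_mod_cast hbad
      rw [← mul_div_assoc, div_le_div_iff₀ (by norm_num) hm']
      have h4 := mul_le_mul_of_nonneg_left h3 (Nat.cast_nonneg A)
      push_cast
      linarith
    rw [acc_true, mul_one] at h1
    linarith
  · set Z := zeroRel ι m M with hZdef
    set Y : ℕ → ℕ → Prop := fun i j => Z i j ∧ Steady Z m W i ∧ Steady Z m W j with hY
    have hz0 : Z 0 0 := hv0.1.1.1.2.2 (Or.inl (self_mem_ancestors m 0))
    have hz1 : Z (m - 1) (m - 1) :=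
      (ZPath.right hv1.1.1).2.2 (Or.inl (self_mem_ancestors m (m - 1)))
    -- Of at least `m / L` breaks fewer than `m / (2 * L)` are spoiled; hence the windows are scaled
    -- by `2 * L`.
    have hcard : ∀ T : Finset ℕ, ∀ b : ℕ, b ≤ T.card + 2 * (unsteady Z m W).card → m ≤ b * L →
        m ≤ T.card * (2 * L) := by
      intro T b h1 h2
      push Not at hbad
      have := Nat.mul_le_mul_right L h1
      nlinarith
    have hsteady : ∀ {a b : ℕ}, b < m → (∀ y ∈ unsteady Z m W, ¬ (a ≤ y ∧ y ≤ b)) →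
        ∀ x, a ≤ x → x ≤ b → VerySteady Z m W x := by
      intro a b hb h x h1 h2
      by_contra hcon
      exact h x (Finset.mem_filter.2 ⟨Finset.mem_range.2 (by omega), hcon⟩) ⟨h1, h2⟩
    have main : ∀ Y' : ℕ → ℕ → Prop, m ≤ (breaks Y' (m - 1)).card * L →
        (∀ {a b}, b < m → ¬ Crossable Y' a b → (∀ y ∈ unsteady Z m W, ¬ (a ≤ y ∧ y ≤ b)) →
          ¬ Crossable Z a b ∨ ¬ Crossable (transp Z) a b) →
        acc M (sampleTest ι m (scales A (2 * L)) K) ≤ acc M next + Real.exp (-(A / 4 : ℝ)) := by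
      intro Y' hb hcross
      have h1 := acc_sampleTest_scales_le (M := M) (ι := ι) (A := A) hm
        (T := (breaks Y' (m - 1)).filter fun x =>
          ∀ y ∈ unsteady Z m W, ¬ (pieceStart Y' x ≤ y ∧ y ≤ x + 1))
        (lo := pieceStart Y') (fun x _ => pieceStart_le Y' x)
        (fun x hx => by have := (mem_breaks.1 (Finset.mem_filter.1 hx).1).1; omega)
        (fun x hx x' _ h => breaks_disjoint (mem_breaks.1 (Finset.mem_filter.1 hx).1).2 h)
        (hcard _ _ (card_breaks_le_filter Y' (m - 1) (unsteady Z m W)) hb)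
        (fun x hx => by
          have hx' := Finset.mem_filter.1 hx
          have hx1 := mem_breaks.1 hx'.1
          exact hcross (by omega) hx1.2 hx'.2) K
      have h2 := mul_le_of_le_one_right hexp (acc_le_one (M := M) K)
      linarith
    have hWL' : 88 * ((2 * W : ℕ) : ℝ) ≤ ε * L := by push_cast; linarith
    rcases many_breaks (Z' := Y) hε (fun _ _ h => h.1) (local_steady hZ) ⟨hz0, hv0.1, hv0.1⟩
      ⟨hz1, hv1.1, hv1.1⟩ hWL' hLm (hfar hz0 hz1) with h | h
    · exact main Y h fun hb hc hu => Or.inl fun hcon => hc (hcon.steady (hsteady hb hu))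
    · refine main (transp Y) h fun hb hc hu => Or.inr fun hcon => hc ?_
      refine (hcon.steady fun x h1 h2 => (hsteady hb hu x h1 h2).transp).mono ?_
      rintro x y - - ⟨h1, h2, h3⟩
      exact ⟨h1, h3.transp, h2.transp⟩

/-- The errors telescope: `1 / (5 * (j + 1)) = 1 / (5 * (j + 2)) + 1 / (5 * (j + 1) * (j + 2))`. -/
lemma acc_unknownTester_le (hm : 0 < m) {W L A : ℕ → ℕ} {ε : ℝ} (hε : 0 < ε)
    (hWL : ∀ j, 176 * (W j : ℝ) ≤ ε * L j)
    (hA : ∀ j : ℕ, Real.exp (-(A j / 4 : ℝ)) ≤ 1 / (5 * (j + 1) * (j + 2)))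
    (hfar : zeroRel ι m M 0 0 → zeroRel ι m M (m - 1) (m - 1) → ∀ k : ℕ,
      CReach (zeroRel ι m M) k (0, 0) (m - 1, m - 1) → ε * m < 2 * k) (f j : ℕ) :
    acc M (unknownTester ι m W A L f j) ≤ 1 / (5 * (j + 1)) := by
  have hfull : ∀ j : ℕ, acc M (fullTest ι m) ≤ 1 / (5 * (j + 1)) := fun j => by
    rw [acc_fullTest_eq_zero hfar hε]; positivity
  induction f generalizing j with
  | zero => exact hfull j
  | succ f ih =>
    rw [unknownTester]
    split_ifs with h
    · exact hfull j
    · refine (acc_round_le hm hε (hWL j) (by omega) hfar _).trans ?_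
      refine (add_le_add (ih (j + 1)) (hA j)).trans (le_of_eq ?_)
      push_cast
      field_simp
      ring

/-! ### Numbers of queries -/

lemma length_window_le (m h y : ℕ) : (window m h y).length ≤ 2 * h + 1 := by
  rw [window, ← List.toFinset_card_of_nodup (List.nodup_range.filter _)]
  calc _ ≤ (Finset.Icc (y - h) (y + h)).card := Finset.card_le_card fun x hx => by
        simp only [List.mem_toFinset, List.mem_filter, decide_eq_true_eq] at hx
        rw [Finset.mem_Icc]
        omega
    _ ≤ _ := by rw [Nat.card_Icc]; omega

lemma queryCount_fullTest_le : (fullTest ι m).queryCount M ≤ 2 * m := by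
  have := queryCount_verify_le (M := M) (ι := ι) (m := m) (B := 0) (List.range m)
    (fun _ => .answer true) le_rfl
  simpa [fullTest] using this

lemma queryCount_sampleTest_le (hm : 0 < m) (hs : List ℕ) {K : QueryAlgorithm n} {B : ℕ}
    (hK : K.queryCount M ≤ B) :
    (sampleTest ι m hs K).queryCount M ≤ (hs.map fun h => 2 * (2 * h + 1)).sum + B := by
  induction hs with
  | nil => simpa [sampleTest] using hK
  | cons h hs ih =>
    rw [sampleTest, List.map_cons, List.sum_cons]
    refine queryCount_drawIndex_le hm _ fun y _ => ?_
    have h1 := queryCount_verify_le (M := M) (ι := ι) (m := m) (window m h y)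
      (fun _ => sampleTest ι m hs K) ih
    have := length_window_le m h y
    omega

/-- A window of radius `h = 2 ^ k` costs at most `6 * h` queries, so scale `k` costs at most `6 * (A
* L + 2 ^ k)`, and the powers of two add up to at most `8 * L`. -/
lemma sum_scales_le (A : ℕ) {L κ : ℕ} (hL : 0 < L) (hκ : Nat.clog 2 (2 * L) + 1 ≤ κ) :
    ((scales A L).map fun h => 2 * (2 * h + 1)).sum ≤ 6 * (κ * (A * L) + 8 * L) := by
  rw [scales, sum_map_flatMap_replicate]
  have h1 : ∀ k, (A * L / 2 ^ k + 1) * (2 * (2 * 2 ^ k + 1)) ≤ 6 * (A * L + 2 ^ k) := by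
    intro k
    have h2 := Nat.div_mul_le_self (A * L) (2 ^ k)
    have h3 : 1 ≤ 2 ^ k := Nat.one_le_two_pow
    nlinarith [Nat.zero_le (A * L / 2 ^ k)]
  have h2 := two_pow_clog_le (show 1 ≤ 2 * L by omega)
  have h3 : ∀ κ, ∑ k ∈ Finset.range κ, 2 ^ k ≤ 2 ^ κ := by
    intro κ
    induction κ with
    | zero => simp
    | succ κ ih => rw [Finset.sum_range_succ, pow_succ]; omega
  refine (Finset.sum_le_sum fun k _ => h1 k).trans ?_
  rw [← Finset.mul_sum, Finset.sum_add_distrib, Finset.sum_const, Finset.card_range, smul_eq_mul]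
  have h4 := h3 (Nat.clog 2 (2 * L) + 1)
  rw [pow_succ] at h4
  have h5 := Nat.mul_le_mul_right (A * L) hκ
  omega

lemma queryCount_knownTester_le (hm : 0 < m) {A L : ℕ} (hL : 0 < L) :
    (knownTester ι m A L).queryCount M ≤
      6 * ((Nat.clog 2 (2 * L) + 1) * (A * L) + 8 * L) + 4 := by
  rw [knownTester]
  split_ifs with h
  · refine queryCount_fullTest_le.trans ?_
    omega
  · have h1 := queryCount_sampleTest_le (M := M) (ι := ι) (B := 0) hm (scales A L)
      (K := .answer true) le_rfl
    have h2 := queryCount_verify_le (M := M) (ι := ι) (m := m) [0, m - 1]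
      (fun _ => sampleTest ι m (scales A L) (.answer true)) h1
    have h3 := sum_scales_le A hL le_rfl
    simp only [List.length_cons, List.length_nil] at h2
    omega

/-- Since `y` is its own ancestor, the slope bound confines the zeros of column `y`, and those of
row `y`, to `W + 1` consecutive positions. This needs no locality of the matrix. -/
lemma length_partners_le {V : ℕ → ℕ → Prop} {W y : ℕ} (h : SlopeBounded m W V y) :
    (partners m V y).length ≤ 2 * (W + 1) := by
  classical
  have hset : ∀ p : ℕ → Prop, (∀ r r', p r → p r' → r' ≤ r + W) →
      ((Finset.range m).filter p).card ≤ W + 1 := by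
    intro p hp
    rcases ((Finset.range m).filter p).eq_empty_or_nonempty with he | hne
    · rw [he]; simp
    · set r := ((Finset.range m).filter p).min' hne
      have hr : p r := (Finset.mem_filter.1 (Finset.min'_mem _ hne)).2
      calc _ ≤ (Finset.Icc r (r + W)).card := Finset.card_le_card fun x hx =>
            Finset.mem_Icc.2 ⟨Finset.min'_le _ _ hx, hp _ _ hr (Finset.mem_filter.1 hx).2⟩
        _ = W + 1 := by rw [Nat.card_Icc]; omega
  have hself := h y (self_mem_ancestors m y)
  rw [Nat.sub_self, Nat.add_zero, Nat.mul_one] at hself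
  have h1 := hset (fun r => V y r) fun r r' h1 h2 => ((hself r r').1 h1 h2).1
  have h2 := hset (fun r => V r y) fun r r' h1 h2 => ((hself r r').2 h1 h2).1
  rw [partners, ← List.toFinset_card_of_nodup (List.nodup_range.filter _)]
  have h3 : (List.filter (fun r => decide (V y r ∨ V r y)) (List.range m)).toFinset ⊆
      ((Finset.range m).filter fun r => V y r) ∪ (Finset.range m).filter fun r => V r y := by
    intro x hx
    simp only [List.mem_toFinset, List.mem_filter, List.mem_range, decide_eq_true_eq] at hx
    simp only [Finset.mem_union, Finset.mem_filter, Finset.mem_range]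
    tauto
  have h4 := (Finset.card_le_card h3).trans (Finset.card_union_le _ _)
  omega

lemma length_flatMap_ancestors_le (R : List ℕ) :
    (R.flatMap (ancestors m)).length ≤ R.length * (2 * Nat.log 2 m + 3) := by
  induction R with
  | nil => simp
  | cons a R ih =>
    rw [List.flatMap_cons, List.length_append, List.length_cons, Nat.succ_mul]
    have := length_ancestors_le m a
    omega

/-- The branch `next` is reached only after a violation of the slope bound, which locality rules
out; hence the alternative in `hnext`. -/
lemma queryCount_checkIndex_le {W B : ℕ} (y : ℕ) {next K : QueryAlgorithm n}
    (hnext : next.queryCount M ≤ B ∨ Local (zeroRel ι m M) m W) (hK : K.queryCount M ≤ B) :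
    (checkIndex ι m W y next K).queryCount M ≤
      2 * ((2 * Nat.log 2 m + 3) * (2 * W + 3)) + B := by
  have hZ : ∀ {i j}, zeroRel ι m M i j → i < m ∧ j < m := zeroRel_lt ι m
  set a := 2 * Nat.log 2 m + 3 with ha
  rw [checkIndex]
  refine (queryCount_verify_le (B := 2 * (a * (2 * W + 2)) + B) _ _ ?_).trans ?_
  · split_ifs with h1
    · refine (queryCount_verify_le (B := B) _ _ ?_).trans ?_
      · split_ifs with h2
        · exact hK
        · rcases hnext with h | h
          · exact h
          · refine absurd (fun r hr => ?_) h2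
            exact (slopeBounded_reveal hZ fun a ha => List.mem_flatMap.2 ⟨r, hr, ha⟩).2
              (h.slopeBounded r)
      · have h3 := length_flatMap_ancestors_le (m := m)
          (partners m (reveal (zeroRel ι m M) m (ancestors m y)) y)
        have h4 := Nat.mul_le_mul_right a (length_partners_le h1)
        have h5 : 2 * (W + 1) * a = a * (2 * W + 2) := by ring
        rw [← ha] at h3
        omega
    · rcases hnext with h | h
      · omega
      · exact absurd ((slopeBounded_reveal hZ (List.Subset.refl _)).2 (h.slopeBounded y)) h1
  · have h3 := length_ancestors_le m y
    have h4 : a * (2 * W + 3) = a * (2 * W + 2) + a := by ring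
    omega

lemma queryCount_slopeTest_le (hm : 0 < m) {W B : ℕ} {next K : QueryAlgorithm n}
    (hnext : next.queryCount M ≤ B ∨ Local (zeroRel ι m M) m W) (hK : K.queryCount M ≤ B) (q : ℕ) :
    (slopeTest ι m W next K q).queryCount M ≤
      q * (2 * ((2 * Nat.log 2 m + 3) * (2 * W + 3))) + B := by
  induction q with
  | zero => simpa [slopeTest] using hK
  | succ q ih =>
    rw [slopeTest]
    refine queryCount_drawIndex_le hm _ fun y _ => ?_
    refine (queryCount_checkIndex_le y (hnext.imp_left fun h => ?_) ih).trans ?_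
    · exact h.trans (Nat.le_add_left _ _)
    · rw [Nat.succ_mul q]; omega

/-- The number of queries of a round of the tester for an unknown locality. -/
def roundCost (m W A L : ℕ) : ℕ :=
  6 * ((Nat.log 2 m + 4) * (A * (2 * L)) + 8 * (2 * L)) +
    (A * L + 2) * (2 * ((2 * Nat.log 2 m + 3) * (2 * W + 3)))

/-- Round `J` is the last one, since its checks cannot fail. The recursion depth never interferes:
when it is exhausted, `m ≤ j ≤ L j`, and the full test is within the budget. -/
lemma queryCount_unknownTester_le (hm : 0 < m) {W A L : ℕ → ℕ} (hL0 : ∀ j, 0 < L j)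
    (hL : ∀ j, j ≤ L j) {J : ℕ} (hloc : Local (zeroRel ι m M) m (W J)) (f j : ℕ) (hj : j ≤ J)
    (hfj : m ≤ f + j) : (unknownTester ι m W A L f j).queryCount M ≤
      ∑ i ∈ Finset.Icc j J, roundCost m (W i) (A i) (L i) := by
  have hsum : ∀ j ≤ J, ∑ i ∈ Finset.Icc j J, roundCost m (W i) (A i) (L i) =
      roundCost m (W j) (A j) (L j) + ∑ i ∈ Finset.Icc (j + 1) J, roundCost m (W i) (A i) (L i) :=
    fun j hj => by
      rw [← Finset.sum_Ioc_add_eq_sum_Icc hj, add_comm]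
      congr 1
      exact Finset.sum_congr (by ext x; simp only [Finset.mem_Ioc, Finset.mem_Icc]; omega)
        fun _ _ => rfl
  have hfull : ∀ j ≤ J, m ≤ L j → (fullTest ι m).queryCount M ≤
      ∑ i ∈ Finset.Icc j J, roundCost m (W i) (A i) (L i) := by
    intro j hj h
    refine queryCount_fullTest_le.trans ?_
    rw [hsum j hj]
    simp only [roundCost]
    omega
  induction f generalizing j with
  | zero => exact hfull j hj (by have := hL j; omega)
  | succ f ih =>
    rw [unknownTester]
    split_ifs with h
    · exact hfull j hj h
    · set B := ∑ i ∈ Finset.Icc (j + 1) J, roundCost m (W i) (A i) (L i) with hB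
      have hnext : (unknownTester ι m W A L f (j + 1)).queryCount M ≤ B ∨
          Local (zeroRel ι m M) m (W j) := by
        rcases hj.eq_or_lt with rfl | hlt
        · exact Or.inr hloc
        · exact Or.inl (ih (j + 1) hlt (by omega))
      have h1 := queryCount_slopeTest_le (K := .answer true) hm hnext (Nat.zero_le _) (A j * L j)
      have h2 := queryCount_checkIndex_le (m - 1)
        (hnext.imp_left fun h => h.trans (Nat.le_add_left _ _)) h1
      have h3 := queryCount_checkIndex_le 0
        (hnext.imp_left fun h => h.trans ((Nat.le_add_left _ _).trans (Nat.le_add_left _ _))) h2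
      refine (queryCount_sampleTest_le hm _ h3).trans ?_
      have hκ : Nat.clog 2 (2 * (2 * L j)) + 1 ≤ Nat.log 2 m + 4 := by
        have : Nat.clog 2 (2 * (2 * L j)) ≤ Nat.log 2 m + 3 := by
          refine Nat.clog_le_of_le_pow ?_
          have := Nat.lt_pow_succ_log_self (b := 2) (by norm_num) m
          rw [show Nat.log 2 m + 3 = (Nat.log 2 m + 1) + 2 from rfl, pow_add]
          omega
        omega
      have h4 := sum_scales_le (A j) (show 0 < 2 * L j by have := hL0 j; omega) hκ
      rw [hsum j hj, ← hB, roundCost, Nat.add_mul (A j * L j)]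
      omega

end Unknown

/-! ### Couplings and lattice paths -/

section Couplings

variable {n : ℕ}

/-- The zeros of a matrix, as a relation on natural numbers. -/
def zerosOf (M : Fin n → Fin n → ℕ) (i j : ℕ) : Prop :=
  ∃ (hi : i < n) (hj : j < n), M ⟨i, hi⟩ ⟨j, hj⟩ = 0

/-- `CReach` does not count its starting point; `h0` makes that point free in the coupling as well.
-/
lemma exists_coupling_of_cReach {M : Fin n → Fin n → ℕ} (hM : ∀ i j, M i j ≤ 1) (hn : 0 < n)
    {k : ℕ} {q : ℕ × ℕ} (h : CReach (zerosOf M) k (0, 0) q) (h0 : zerosOf M 0 0) (h1 : q.1 < n)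
    (h2 : q.2 < n) :
    ∃ C : List (Fin n × Fin n), (∀ p ∈ C.head?, (p.1 : ℕ) = 0 ∧ (p.2 : ℕ) = 0) ∧
      C.getLast? = some (⟨q.1, h1⟩, ⟨q.2, h2⟩) ∧ C.IsChain CouplingStep ∧ pathCost M C ≤ k := by
  generalize hp : ((0, 0) : ℕ × ℕ) = p at h
  induction h with
  | refl k p =>
    subst hp
    refine ⟨[(⟨0, hn⟩, ⟨0, hn⟩)], by simp, by simp, by simp, ?_⟩
    obtain ⟨_, _, h0⟩ := h0
    simp [pathCost, h0]
  | @free k p q q' h hs hz ih =>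
    have hle := hs.le
    obtain ⟨C, e1, e2, e3, e4⟩ := ih (by omega) (by omega) hp
    obtain ⟨_, _, hz⟩ := hz
    have hne : C ≠ [] := by rintro rfl; simp at e2
    refine ⟨C ++ [(⟨q'.1, h1⟩, ⟨q'.2, h2⟩)], ?_, by simp, ?_, ?_⟩
    · rwa [List.head?_append_of_ne_nil _ hne]
    · rw [List.isChain_append]
      refine ⟨e3, by simp, fun x hx y hy => ?_⟩
      rw [e2] at hx
      simp only [Option.mem_def, Option.some.injEq, List.head?_cons] at hx hy
      subst hx hy
      exact hs
    · simp only [pathCost, List.map_append, List.sum_append, List.map_cons, List.map_nil,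
        List.sum_cons, List.sum_nil, hz] at e4 ⊢
      omega
  | @paid k p q q' h hs ih =>
    have hle := hs.le
    obtain ⟨C, e1, e2, e3, e4⟩ := ih (by omega) (by omega) hp
    have hne : C ≠ [] := by rintro rfl; simp at e2
    refine ⟨C ++ [(⟨q'.1, h1⟩, ⟨q'.2, h2⟩)], ?_, by simp, ?_, ?_⟩
    · rwa [List.head?_append_of_ne_nil _ hne]
    · rw [List.isChain_append]
      refine ⟨e3, by simp, fun x hx y hy => ?_⟩
      rw [e2] at hx
      simp only [Option.mem_def, Option.some.injEq, List.head?_cons] at hx hy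
      subst hx hy
      exact hs
    · have := hM ⟨q'.1, h1⟩ ⟨q'.2, h2⟩
      simp only [pathCost, List.map_append, List.sum_append, List.map_cons, List.map_nil,
        List.sum_cons, List.sum_nil] at e4 ⊢
      omega

lemma exists_isCoupling {M : Fin n → Fin n → ℕ} (hM : ∀ i j, M i j ≤ 1) (hn : 0 < n) {k : ℕ}
    (h : CReach (zerosOf M) k (0, 0) (n - 1, n - 1)) (h0 : zerosOf M 0 0) :
    ∃ C, IsCoupling C ∧ pathCost M C ≤ k := by
  obtain ⟨C, e1, e2, e3, e4⟩ := exists_coupling_of_cReach hM hn h h0 (by simp only; omega)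
    (by simp only; omega)
  refine ⟨C, ⟨by rintro rfl; simp at e2, e1, fun p hp => ?_, e3⟩, e4⟩
  rw [e2] at hp
  simp only [Option.mem_def, Option.some.injEq] at hp
  subst hp
  simp only
  omega

/-- A coupling, coarsened by a map of indices that increases by at most one in a step. -/
lemma reflTransGen_of_isChain {Z : ℕ → ℕ → Prop} {D : Fin n × Fin n → Prop} {s : ℕ}
    (hD : ∀ p, D p → Z (p.1 / s) (p.2 / s)) (l : List (Fin n × Fin n)) (p : Fin n × Fin n)
    (hl : (p :: l).IsChain CouplingStep) (hall : ∀ x ∈ p :: l, D x) (q : Fin n × Fin n)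
    (hq : (p :: l).getLast? = some q) :
    ReflTransGen (ZStep Z) (p.1 / s, p.2 / s) (q.1 / s, q.2 / s) := by
  induction l generalizing p with
  | nil =>
    simp only [List.getLast?_singleton, Option.some.injEq] at hq
    subst hq
    exact .refl
  | cons x l ih =>
    rw [List.isChain_cons_cons] at hl
    have h1 := ih x hl.2 (fun y hy => hall y (List.mem_cons_of_mem _ hy))
      (by rwa [List.getLast?_cons_cons] at hq)
    have hx := hD x (hall x (by simp))
    have hdiv : ∀ {a b : ℕ}, b = a + 1 → b / s = a / s ∨ b / s = a / s + 1 := by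
      rintro a b rfl
      rw [Nat.succ_div]
      split_ifs <;> simp
    have h2 : (p.1 / s : ℕ) = x.1 / s ∧ (p.2 / s : ℕ) = x.2 / s ∨
        Step (p.1 / s, p.2 / s) (x.1 / s, x.2 / s) := by
      unfold Step
      rcases hl.1 with ⟨e1, e2⟩ | ⟨e1, e2⟩ | ⟨e1, e2⟩
      · rw [e2]; rcases hdiv e1 with h | h <;> simp [h]
      · rw [e1]; rcases hdiv e2 with h | h <;> simp [h]
      · rcases hdiv e1 with h | h <;> rcases hdiv e2 with h' | h' <;> simp [h, h']
    rcases h2 with ⟨e1, e2⟩ | h2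
    · rwa [e1, e2]
    · exact .head ⟨h2, hx⟩ h1

end Couplings

/-! ### From curves to sampled matrices and back. -/

section Curves

variable {X : Type*} [MetricSpace X] {n : ℕ}

lemma freeSpaceMatrix_eq_zero {δ : ℝ} {P Q : Fin n → X} {i j : Fin n} :
    freeSpaceMatrix δ P Q i j = 0 ↔ dist (P i) (Q j) ≤ δ := by
  simp [freeSpaceMatrix]

lemma freeSpaceMatrix_le_one (δ : ℝ) (P Q : Fin n → X) (i j : Fin n) :
    freeSpaceMatrix δ P Q i j ≤ 1 := by
  unfold freeSpaceMatrix; split_ifs <;> simp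

/-- The minimum in the discrete Fréchet distance is attained. -/
lemma exists_coupling_of_discreteFrechetDist_le (hn : 0 < n) {P Q : Fin n → X} {δ : ℝ}
    (h : discreteFrechetDist P Q ≤ δ) :
    ∃ C : List (Fin n × Fin n), IsCoupling C ∧ ∀ p ∈ C, dist (P p.1) (Q p.2) ≤ δ := by
  set F : {C : List (Fin n × Fin n) // IsCoupling C} → ℝ :=
    fun C => ⨆ p : {p : Fin n × Fin n // p ∈ C.1}, dist (P p.1.1) (Q p.1.2) with hF
  have hne : (Set.range F).Nonempty := by
    obtain ⟨C, hC, -⟩ := exists_isCoupling (M := fun _ _ : Fin n => 0) (by simp) hn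
      (CReach.rect _ (Nat.zero_le _) (Nat.zero_le _)) ⟨hn, hn, rfl⟩
    exact ⟨_, ⟨C, hC⟩, rfl⟩
  -- There are infinitely many lists, but every value of `F` is one of the finitely many distances
  -- between vertices.
  have hfin : (Set.range F).Finite := by
    refine (Set.finite_range fun p : Fin n × Fin n => dist (P p.1) (Q p.2)).subset ?_
    rintro _ ⟨C, rfl⟩
    obtain ⟨p, hp⟩ := List.exists_mem_of_ne_nil _ C.2.1
    have : Nonempty {p : Fin n × Fin n // p ∈ C.1} := ⟨⟨p, hp⟩⟩
    obtain ⟨q, hq⟩ := exists_eq_ciSup_of_finite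
      (f := fun p : {p : Fin n × Fin n // p ∈ C.1} => dist (P p.1.1) (Q p.1.2))
    exact ⟨q.1, hq⟩
  obtain ⟨C, hC⟩ := hne.csInf_mem hfin
  refine ⟨C.1, C.2, fun p hp => ?_⟩
  have h1 : F C ≤ δ := by rw [hC]; exact h
  exact (le_ciSup (f := fun p : {p : Fin n × Fin n // p ∈ C.1} => dist (P p.1.1) (Q p.1.2))
    (Set.finite_range _).bddAbove ⟨p, hp⟩).trans h1

lemma dist_le_of_edgeLengthsIn {a α : ℝ} {P : Fin n → X} (hP : EdgeLengthsIn a α P) {i j : ℕ}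
    (hij : i ≤ j) (hj : j < n) : dist (P ⟨i, hij.trans_lt hj⟩) (P ⟨j, hj⟩) ≤ (j - i) * α := by
  induction j, hij using Nat.le_induction with
  | base => simp
  | succ j hij ih =>
    have h1 := (hP j hj).2
    rw [edgeLength, dif_pos hj] at h1
    refine (dist_triangle _ (P ⟨j, by omega⟩) _).trans ?_
    have := ih (by omega)
    push_cast
    linarith

lemma le_dist_of_isStraight {a α t : ℝ} {P : Fin n → X} (hP : EdgeLengthsIn a α P)
    (hs : IsStraight t P) {i j : ℕ} (hij : i ≤ j) (hj : j < n) :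
    (j - i) * a ≤ t * dist (P ⟨i, hij.trans_lt hj⟩) (P ⟨j, hj⟩) := by
  refine le_trans ?_ (hs _ _ (Fin.mk_le_mk.2 hij))
  rw [subcurveLength]
  calc (j - i) * a = ∑ k ∈ Finset.Ico i j, a := by
        rw [Finset.sum_const, Nat.card_Ico, nsmul_eq_mul, Nat.cast_sub hij]
    _ ≤ _ := Finset.sum_le_sum fun k hk => (hP k (by rw [Finset.mem_Ico] at hk; omega)).1

/-! ### Coarsening -/

/-- The index of the `i`-th sampled vertex, if every `s`-th vertex is sampled. -/
def sampled (hn : 0 < n) (s i : ℕ) : Fin n := ⟨min (i * s) (n - 1), by omega⟩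

lemma sampled_eq (hn : 0 < n) {s i : ℕ} (h : i * s < n) : sampled hn s i = ⟨i * s, h⟩ := by
  unfold sampled
  congr
  omega

lemma mul_lt_of_lt {s i : ℕ} (hn : 0 < n) (hi : i < (n - 1) / s + 1) : i * s < n := by
  have h1 := Nat.mul_le_mul_right s (show i ≤ (n - 1) / s by omega)
  have h2 := Nat.div_mul_le_self (n - 1) s
  omega

variable {P Q : Fin n → X} {a α δ ρ : ℝ} {s : ℕ}

lemma zeroRel_sampled_iff (hn : 0 < n) {i j : ℕ} :
    zeroRel (sampled hn s) ((n - 1) / s + 1) (freeSpaceMatrix ρ P Q) i j ↔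
      ∃ (hi : i < (n - 1) / s + 1) (hj : j < (n - 1) / s + 1),
        dist (P ⟨i * s, mul_lt_of_lt hn hi⟩) (Q ⟨j * s, mul_lt_of_lt hn hj⟩) ≤ ρ := by
  constructor
  · rintro ⟨hi, hj, h⟩
    refine ⟨hi, hj, ?_⟩
    rwa [freeSpaceMatrix_eq_zero, sampled_eq hn (mul_lt_of_lt hn hi),
      sampled_eq hn (mul_lt_of_lt hn hj)] at h
  · rintro ⟨hi, hj, h⟩
    refine ⟨hi, hj, ?_⟩
    rwa [freeSpaceMatrix_eq_zero, sampled_eq hn (mul_lt_of_lt hn hi),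
      sampled_eq hn (mul_lt_of_lt hn hj)]

lemma dist_sampled_le (hP : EdgeLengthsIn a α P) (hα : 0 ≤ α) {i x : ℕ} (hx : x < s)
    (h : i * s + x < n) : dist (P ⟨i * s, by omega⟩) (P ⟨i * s + x, h⟩) ≤ (s - 1) * α := by
  refine (dist_le_of_edgeLengthsIn hP (Nat.le_add_right _ _) h).trans ?_
  have : (x : ℝ) + 1 ≤ s := by exact_mod_cast hx
  refine mul_le_mul_of_nonneg_right ?_ hα
  push_cast
  linarith

/-- Close curves have a path of zeros in the coarsened matrix. -/
lemma consistent_of_discreteFrechetDist_le (hn : 0 < n) (hs : 0 < s)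
    (hP : EdgeLengthsIn a α P) (hQ : EdgeLengthsIn a α Q) (hα : 0 ≤ α)
    (hρ : δ + 2 * (s - 1) * α ≤ ρ) (h : discreteFrechetDist P Q ≤ δ) :
    Consistent ((n - 1) / s + 1)
      (zeroRel (sampled hn s) ((n - 1) / s + 1) (freeSpaceMatrix ρ P Q)) := by
  obtain ⟨C, ⟨hC1, hC2, hC3, hC4⟩, hC⟩ := exists_coupling_of_discreteFrechetDist_le hn h
  have hD : ∀ p : Fin n × Fin n, dist (P p.1) (Q p.2) ≤ δ →
      zeroRel (sampled hn s) ((n - 1) / s + 1) (freeSpaceMatrix ρ P Q) (p.1 / s) (p.2 / s) := by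
    rintro ⟨⟨i, hi⟩, ⟨j, hj⟩⟩ hp
    refine (zeroRel_sampled_iff hn).2 ⟨Nat.lt_succ_of_le (Nat.div_le_div_right (by simp only; omega)),
      Nat.lt_succ_of_le (Nat.div_le_div_right (by simp only; omega)), ?_⟩
    have ei := Nat.div_add_mod' i s
    have ej := Nat.div_add_mod' j s
    have h1 := dist_sampled_le (i := i / s) (x := i % s) hP hα (Nat.mod_lt _ hs) (by omega)
    have h2 := dist_sampled_le (i := j / s) (x := j % s) hQ hα (Nat.mod_lt _ hs) (by omega)
    simp only [ei, ej] at h1 h2 hp ⊢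
    rw [dist_comm] at h2
    have h3 := dist_triangle4 (P ⟨i / s * s, by omega⟩) (P ⟨i, hi⟩) (Q ⟨j, hj⟩)
      (Q ⟨j / s * s, by omega⟩)
    linarith
  obtain ⟨p, l, rfl⟩ := List.exists_cons_of_ne_nil hC1
  obtain ⟨q, hq⟩ : ∃ q, (p :: l).getLast? = some q := ⟨_, List.getLast?_eq_some_getLast hC1⟩
  have hp := hC2 p (by simp)
  have hq' := hC3 q hq
  have key := reflTransGen_of_isChain (s := s) hD l p hC4 hC q hq
  have hz := hD p (hC p (by simp))
  rw [hp.1, hp.2, Nat.zero_div] at key hz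
  rw [show (q.1 : ℕ) = n - 1 by omega, show (q.2 : ℕ) = n - 1 by omega] at key
  exact ⟨hz, key⟩

/-! ### Refining a coarse path -/

lemma cReach_line {Z : ℕ → ℕ → Prop} {i j dx dy x : ℕ} (hd : dx ≤ 1 ∧ dy ≤ 1 ∧ 1 ≤ dx + dy) :
    CReach Z x (i, j) (i + x * dx, j + x * dy) := by
  induction x with
  | zero => simpa using CReach.refl 0 _
  | succ x ih =>
    refine .paid ih ?_
    obtain ⟨h1, h2, h3⟩ := hd
    unfold Step
    interval_cases dx <;> interval_cases dy <;> simp at * <;> omega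

lemma cReach_free_line {Z : ℕ → ℕ → Prop} {i j dx dy x : ℕ}
    (hd : dx ≤ 1 ∧ dy ≤ 1 ∧ 1 ≤ dx + dy) (hZ : ∀ y ≤ x, Z (i + y * dx) (j + y * dy)) :
    CReach Z 0 (i, j) (i + x * dx, j + x * dy) := by
  induction x with
  | zero => simpa using CReach.refl 0 _
  | succ x ih =>
    refine .free (ih fun y hy => hZ y (by omega)) ?_ (hZ _ le_rfl)
    obtain ⟨h1, h2, h3⟩ := hd
    unfold Step
    interval_cases dx <;> interval_cases dy <;> simp at * <;> omega

lemma Step.exists_eq_add {p q : ℕ × ℕ} (h : Step p q) :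
    ∃ dx dy, (dx ≤ 1 ∧ dy ≤ 1 ∧ 1 ≤ dx + dy) ∧ q = (p.1 + dx, p.2 + dy) := by
  rcases h with ⟨h1, h2⟩ | ⟨h1, h2⟩ | ⟨h1, h2⟩
  · exact ⟨1, 0, by simp, Prod.ext h1 h2⟩
  · exact ⟨0, 1, by simp, Prod.ext h1 h2⟩
  · exact ⟨1, 1, by simp, Prod.ext h1 h2⟩

open Classical in
/-- Walking from the corner of a cell to the last point before the corner of the next cell. -/
lemma cReach_cell {Z F : ℕ → ℕ → Prop} {m N s : ℕ} (hmN : (m - 1) * (s + 1) < N)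
    (hF : ∀ i j x y, Z i j → x ≤ s → y ≤ s → i * (s + 1) + x < N → j * (s + 1) + y < N →
      F (i * (s + 1) + x) (j * (s + 1) + y))
    {i j dx dy : ℕ} (hd : dx ≤ 1 ∧ dy ≤ 1 ∧ 1 ≤ dx + dy) (hi : i + dx ≤ m - 1)
    (hj : j + dy ≤ m - 1) :
    CReach F (if Z i j then 0 else s) (i * (s + 1), j * (s + 1))
      (i * (s + 1) + s * dx, j * (s + 1) + s * dy) := by
  split_ifs with hz
  · have hb : ∀ {i d y : ℕ}, d ≤ 1 → i + d ≤ m - 1 → y ≤ s → i * (s + 1) + y * d < N := by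
      intro i d y hd hi hy
      have h1 := Nat.mul_le_mul_right (s + 1) hi
      rw [Nat.add_mul] at h1
      have h2 : y * d ≤ d * (s + 1) := by
        rw [mul_comm]; exact Nat.mul_le_mul_left _ (by omega)
      omega
    have hx : ∀ {d y : ℕ}, d ≤ 1 → y ≤ s → y * d ≤ s := fun {d y} hd hy =>
      (Nat.mul_le_mul_left y hd).trans (by omega)
    exact cReach_free_line hd fun y hy => hF i j _ _ hz (hx hd.1 hy) (hx hd.2.1 hy)
      (hb hd.1 hi hy) (hb hd.2.1 hj hy)
  · exact cReach_line hd

/-- A path between cells of side `s + 1` gives a path between their corners. -/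
lemma cReach_refine {Z F : ℕ → ℕ → Prop} {m N s k : ℕ} {q : ℕ × ℕ} (hmN : (m - 1) * (s + 1) < N)
    (hF : ∀ i j x y, Z i j → x ≤ s → y ≤ s → i * (s + 1) + x < N → j * (s + 1) + y < N →
      F (i * (s + 1) + x) (j * (s + 1) + y)) (h0 : Z 0 0) (h : CReach Z k (0, 0) q)
    (h1 : q.1 ≤ m - 1) (h2 : q.2 ≤ m - 1) :
    ∃ k', (Z q.1 q.2 ∧ k' ≤ (s + 1) * k ∨ k' + s ≤ (s + 1) * k) ∧
      CReach F k' (0, 0) (q.1 * (s + 1), q.2 * (s + 1)) := by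
  classical
  generalize hp : ((0, 0) : ℕ × ℕ) = p at h
  -- Entering a cell of ones costs `1` and walking to its far end costs up to `s` more. The
  -- invariant therefore keeps `s` in reserve at such a cell, and none at a cell of zeros, which is
  -- traversed free.
  have hwalk : ∀ {k : ℕ} {q q' : ℕ × ℕ}, Step q q' → q'.1 ≤ m - 1 → q'.2 ≤ m - 1 →
      (∃ k', (Z q.1 q.2 ∧ k' ≤ (s + 1) * k ∨ k' + s ≤ (s + 1) * k) ∧
        CReach F k' (0, 0) (q.1 * (s + 1), q.2 * (s + 1))) →
      ∃ z, CReach F ((s + 1) * k) (0, 0) z ∧ Step z (q'.1 * (s + 1), q'.2 * (s + 1)) := by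
    rintro k ⟨i, j⟩ q' hs h1 h2 ⟨k', hk', hr⟩
    obtain ⟨dx, dy, hd, rfl⟩ := hs.exists_eq_add
    refine ⟨_, (hr.trans (cReach_cell hmN hF hd h1 h2)).mono ?_, ?_⟩
    · split_ifs with hz
      · omega
      · rcases hk' with h | h
        · exact absurd h.1 hz
        · exact h
    · obtain ⟨h1, h2, h3⟩ := hd
      unfold Step
      simp only [Nat.add_mul]
      interval_cases dx <;> interval_cases dy <;> simp at * <;> omega
  induction h with
  | refl k p =>
    subst hp
    exact ⟨0, Or.inl ⟨h0, Nat.zero_le _⟩, by simpa using CReach.refl 0 _⟩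
  | @free k p q q' h hs hz ih =>
    subst hp
    have hle := hs.le
    obtain ⟨z, hz1, hz2⟩ := hwalk hs h1 h2 (ih (by omega) (by omega) rfl)
    have hb : ∀ {i}, i ≤ m - 1 → i * (s + 1) + 0 < N := fun {i} hi => by
      have := Nat.mul_le_mul_right (s + 1) hi
      omega
    exact ⟨_, Or.inl ⟨hz, le_rfl⟩, .free hz1 hz2
      (hF _ _ 0 0 hz (Nat.zero_le _) (Nat.zero_le _) (hb h1) (hb h2))⟩
  | @paid k p q q' h hs ih =>
    subst hp
    have hle := hs.le
    obtain ⟨z, hz1, hz2⟩ := hwalk hs h1 h2 (ih (by omega) (by omega) rfl)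
    exact ⟨_, Or.inr (by rw [Nat.mul_add]; omega), .paid hz1 hz2⟩

/-- In far pairs every coarse path is expensive. -/
lemma lt_of_isFar {ε η : ℝ} (hn : 0 < n) (hs : 0 < s) (hε : 0 < ε) (hε2 : ε < 2)
    (hP : EdgeLengthsIn a α P) (hQ : EdgeLengthsIn a α Q) (hα : 0 ≤ α)
    (hη : ρ + 2 * (s - 1) * α ≤ η) (hfar : IsFar ε η P Q) {m : ℕ} (hm : m = (n - 1) / s + 1)
    (h0 : zeroRel (sampled hn s) m (freeSpaceMatrix ρ P Q) 0 0)
    (h1 : zeroRel (sampled hn s) m (freeSpaceMatrix ρ P Q) (m - 1) (m - 1)) {k : ℕ}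
    (hk : CReach (zeroRel (sampled hn s) m (freeSpaceMatrix ρ P Q)) k (0, 0) (m - 1, m - 1)) :
    ε * m < 2 * k := by
  obtain ⟨s, rfl⟩ : ∃ s', s = s' + 1 := ⟨s - 1, by omega⟩
  have hm1 : 1 ≤ m := hm ▸ Nat.le_add_left _ _
  have hmN : (m - 1) * (s + 1) < n :=
    mul_lt_of_lt hn (by rw [hm, Nat.add_sub_cancel]; exact Nat.lt_succ_self _)
  have hF : ∀ i j x y, zeroRel (sampled hn (s + 1)) m (freeSpaceMatrix ρ P Q) i j → x ≤ s → y ≤ s →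
      i * (s + 1) + x < n → j * (s + 1) + y < n →
      zerosOf (freeSpaceMatrix η P Q) (i * (s + 1) + x) (j * (s + 1) + y) := by
    intro i j x y hz hx hy hi hj
    refine ⟨hi, hj, freeSpaceMatrix_eq_zero.2 ?_⟩
    subst hm
    obtain ⟨hi', hj', hz⟩ := (zeroRel_sampled_iff hn).1 hz
    have e1 := dist_sampled_le (x := x) hP hα (by omega) hi
    have e2 := dist_sampled_le (x := y) hQ hα (by omega) hj
    rw [dist_comm] at e1
    have h3 := dist_triangle4 (P ⟨i * (s + 1) + x, hi⟩) (P ⟨i * (s + 1), by omega⟩)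
      (Q ⟨j * (s + 1), by omega⟩) (Q ⟨j * (s + 1) + y, hj⟩)
    linarith
  obtain ⟨k', hk', hr⟩ := cReach_refine hmN hF h0 hk le_rfl le_rfl
  have hk'' : k' ≤ (s + 1) * k := by omega
  -- The last sampled vertex need not be the last vertex; the remaining `d ≤ s` diagonal steps stay
  -- in a cell of zeros.
  obtain ⟨d, hd⟩ : ∃ d, n - 1 = (m - 1) * (s + 1) + d := ⟨n - 1 - (m - 1) * (s + 1), by omega⟩
  have hds : d ≤ s := by
    have := Nat.lt_mul_div_succ (n - 1) hs
    rw [← hm] at this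
    obtain ⟨m', rfl⟩ : ∃ m', m = m' + 1 := ⟨m - 1, by omega⟩
    rw [Nat.add_sub_cancel] at hd
    have e : (s + 1) * (m' + 1) = m' * (s + 1) + (s + 1) := by ring
    omega
  have hlast := cReach_free_line (Z := zerosOf (freeSpaceMatrix η P Q)) (i := (m - 1) * (s + 1))
    (j := (m - 1) * (s + 1)) (dx := 1) (dy := 1) (x := d) (by simp) fun y hy =>
      hF _ _ _ _ h1 (by omega) (by omega) (by omega) (by omega)
  rw [Nat.mul_one, ← hd] at hlast
  have h00 : zerosOf (freeSpaceMatrix η P Q) 0 0 := by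
    simpa using hF 0 0 0 0 h0 (Nat.zero_le _) (Nat.zero_le _) (by omega) (by omega)
  obtain ⟨C, hC, hcost⟩ := exists_isCoupling (freeSpaceMatrix_le_one η P Q) hn (hr.trans hlast) h00
  have hlt : ε * n < (s + 1) * k := by
    by_contra! hcon
    refine hfar ⟨C, hC, le_trans ?_ hcon⟩
    exact_mod_cast hcost.trans hk''
  have hk0 : 0 < k := by
    rcases Nat.eq_zero_or_pos k with rfl | h
    · have : 0 ≤ ε * n := by positivity
      norm_num at hlt
      linarith
    · exact h
  have hk1 : (1 : ℝ) ≤ k := by exact_mod_cast hk0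
  -- The factor `2` absorbs the rounding in `m`, as `(s + 1) * m ≤ 2 * n` for `m ≥ 2`. For `m = 1`
  -- the claim follows from `ε < 2 ≤ 2 * k`.
  rcases Nat.lt_or_ge 1 m with h | h
  · have e1 : (s + 1) * m ≤ 2 * n := by
      have : (s + 1) * m ≤ 2 * ((m - 1) * (s + 1)) := by
        rw [mul_comm, ← mul_assoc]
        exact Nat.mul_le_mul_right _ (by omega)
      omega
    have e2 : ((s : ℝ) + 1) * m ≤ 2 * n := by exact_mod_cast e1
    have e3 := mul_le_mul_of_nonneg_left e2 hε.le
    have hs0 : (0 : ℝ) < s + 1 := by positivity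
    refine lt_of_mul_lt_mul_left ?_ hs0.le
    nlinarith
  · have : m = 1 := by omega
    subst this
    push_cast
    linarith

/-- The zeros in the coarsened matrix of straight curves are local. -/
lemma local_of_isStraight {t : ℝ} {W : ℕ} (hn : 0 < n) (ha : 0 < a) (ht : 0 ≤ t)
    (hP : EdgeLengthsIn a α P) (hQ : EdgeLengthsIn a α Q) (hPs : IsStraight t P)
    (hQs : IsStraight t Q) (hW1 : t * (2 * ρ) ≤ W * (s * a)) (hW2 : t * α ≤ W * a) (hs : 0 < s)
    {m : ℕ} (hm : m = (n - 1) / s + 1) :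
    Local (zeroRel (sampled hn s) m (freeSpaceMatrix ρ P Q)) m W := by
  have hs' : (0 : ℝ) < s := by exact_mod_cast hs
  have hdist : ∀ {P : Fin n → X}, EdgeLengthsIn a α P → ∀ {r r' : ℕ} (hr : r * s < n)
      (hr' : r' * s < n), dist (P ⟨r * s, hr⟩) (P ⟨r' * s, hr'⟩) ≤
        ((r - r' : ℕ) + (r' - r : ℕ)) * (s * α) := by
    intro P hP r r' hr hr'
    rcases le_total r r' with h | h
    · refine (dist_le_of_edgeLengthsIn hP (Nat.mul_le_mul_right s h) hr').trans (le_of_eq ?_)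
      rw [Nat.sub_eq_zero_of_le h, Nat.cast_sub h]
      push_cast
      ring
    · rw [dist_comm]
      refine (dist_le_of_edgeLengthsIn hP (Nat.mul_le_mul_right s h) hr).trans (le_of_eq ?_)
      rw [Nat.sub_eq_zero_of_le h, Nat.cast_sub h]
      push_cast
      ring
  -- Straightness turns distances into index differences: `t * (2 * ρ)` accounts for `W` sampled
  -- steps, and each edge bundle of length `s * α` for another `W`.
  have key : ∀ {P : Fin n → X}, EdgeLengthsIn a α P → IsStraight t P → ∀ {c c' e : ℕ}
      (hc : c * s < n) (hc' : c' * s < n),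
      dist (P ⟨c * s, hc⟩) (P ⟨c' * s, hc'⟩) ≤ 2 * ρ + e * (s * α) → c' ≤ c + W * (1 + e) := by
    intro P hP hPs c c' e hc hc' hd
    rcases le_total c' c with h | h
    · exact h.trans (Nat.le_add_right _ _)
    · have h1 := le_dist_of_isStraight hP hPs (Nat.mul_le_mul_right s h) hc'
      have h2 := mul_le_mul_of_nonneg_left hd ht
      have h3 : ((c' : ℝ) - c) * (s * a) ≤ (W * (1 + e)) * (s * a) := by
        have h4 : e * s * (t * α) ≤ e * s * (W * a) := by gcongr
        push_cast at h1
        nlinarith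
      have h5 : (c' : ℝ) - c ≤ W * (1 + e) := le_of_mul_le_mul_right h3 (by positivity)
      have h6 : (c' : ℝ) ≤ c + W * (1 + e) := by linarith
      exact_mod_cast h6
  subst hm
  refine ⟨fun h => ⟨h.1, h.2.1⟩, fun {c r c' r'} h h' => ?_, fun {c r c' r'} h h' => ?_⟩
  all_goals
    obtain ⟨h1, h2, hz⟩ := (zeroRel_sampled_iff hn).1 h
    obtain ⟨h1', h2', hz'⟩ := (zeroRel_sampled_iff hn).1 h'
    rw [add_assoc 1]
  · refine key hQ hQs (mul_lt_of_lt hn h2) (mul_lt_of_lt hn h2') ?_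
    have e1 := hdist hP (mul_lt_of_lt hn h1) (mul_lt_of_lt hn h1')
    have e2 := dist_triangle4 (Q ⟨r * s, mul_lt_of_lt hn h2⟩) (P ⟨c * s, mul_lt_of_lt hn h1⟩)
      (P ⟨c' * s, mul_lt_of_lt hn h1'⟩) (Q ⟨r' * s, mul_lt_of_lt hn h2'⟩)
    rw [dist_comm (Q _) (P _)] at e2
    push_cast
    linarith
  · refine key hP hPs (mul_lt_of_lt hn h1) (mul_lt_of_lt hn h1') ?_
    have e1 := hdist hQ (mul_lt_of_lt hn h2) (mul_lt_of_lt hn h2')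
    have e2 := dist_triangle4 (P ⟨c * s, mul_lt_of_lt hn h1⟩) (Q ⟨r * s, mul_lt_of_lt hn h2⟩)
      (Q ⟨r' * s, mul_lt_of_lt hn h2'⟩) (P ⟨c' * s, mul_lt_of_lt hn h1'⟩)
    rw [dist_comm (Q _) (P _)] at e2
    push_cast
    linarith

end Curves

/-! ### Numerical estimates -/

lemma half_le_log_two : (1 / 2 : ℝ) ≤ Real.log 2 := by
  have := Real.log_two_gt_d9
  linarith

lemma half_le_log {x : ℝ} (hx : 2 ≤ x) : 1 / 2 ≤ Real.log x :=
  half_le_log_two.trans (Real.log_le_log (by norm_num) hx)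

lemma nat_le_two_mul_log {k : ℕ} {y : ℝ} (h : (2 : ℝ) ^ k ≤ y) : (k : ℝ) ≤ 2 * Real.log y := by
  have h1 := Real.log_le_log (by positivity) h
  rw [Real.log_pow] at h1
  have h2 := mul_le_mul_of_nonneg_left half_le_log_two (Nat.cast_nonneg (α := ℝ) k)
  linarith

lemma clog_le_log {y : ℕ} {z : ℝ} (hy : 1 ≤ y) (hz : y ≤ z) :
    (Nat.clog 2 y : ℝ) ≤ 2 * Real.log z + 2 := by
  have h1 : (2 : ℝ) ^ Nat.clog 2 y ≤ 2 * z := by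
    have : ((2 ^ Nat.clog 2 y : ℕ) : ℝ) ≤ ((2 * y : ℕ) : ℝ) := by exact_mod_cast two_pow_clog_le hy
    push_cast at this
    linarith
  have hy' : (1 : ℝ) ≤ y := by exact_mod_cast hy
  have h2 := nat_le_two_mul_log h1
  rw [Real.log_mul (by norm_num) (by linarith)] at h2
  have h3 := Real.log_two_lt_d9
  linarith

/-- The logarithm is the number of scales, `clog 2 (2 * L) + 1`; `ε < 2` keeps `t / (ε * e)` above
`1 / 2`. -/
lemma knownCost_le {γ t ε e : ℝ} (hγ : 1 ≤ γ) (ht : 1 ≤ t) (hε : 0 < ε) (hε2 : ε < 2) (he : 0 < e)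
    (he1 : e ≤ 1) {L : ℕ} (hL : 0 < L) (hLle : L ≤ 1530 * γ * (t / (ε * e))) :
    ((6 * ((Nat.clog 2 (2 * L) + 1) * (8 * L) + 8 * L) + 4 : ℕ) : ℝ) ≤
      52 * (1530 * γ) * (4 * Real.log (2 * (1530 * γ)) + 10) * knownBound t ε e := by
  set x := t / (ε * e) with hx
  set c := 1530 * γ with hc
  have hx0 : 1 / 2 ≤ x := by
    rw [hx, div_le_div_iff₀ (by norm_num) (by positivity)]
    nlinarith
  have hl := half_le_log (show 2 ≤ 2 + x by linarith)
  have hL1 : (1 : ℝ) ≤ L := by exact_mod_cast hL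
  have h1 := clog_le_log (y := 2 * L) (z := 2 * c * x) (by omega) (by push_cast; linarith)
  have hc0 : 0 < c := by positivity
  rw [Real.log_mul (by positivity) (by positivity)] at h1
  have h2 : Real.log x ≤ Real.log (2 + x) := Real.log_le_log (by linarith) (by linarith)
  have h3 : 0 ≤ Real.log (2 * c) := Real.log_nonneg (by linarith)
  have h4 : (Nat.clog 2 (2 * L) : ℝ) + 2 ≤ (4 * Real.log (2 * c) + 10) * Real.log (2 + x) := by
    nlinarith
  push_cast
  calc (6 * (((Nat.clog 2 (2 * L) : ℝ) + 1) * (8 * L) + 8 * L) + 4)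
      ≤ 52 * L * ((Nat.clog 2 (2 * L) : ℝ) + 2) := by
        have : 0 ≤ (Nat.clog 2 (2 * L) : ℝ) := Nat.cast_nonneg _
        nlinarith
    _ ≤ 52 * (c * x) * ((4 * Real.log (2 * c) + 10) * Real.log (2 + x)) := by gcongr
    _ = _ := by rw [knownBound]; ring

lemma roundCost_le {m W A L : ℕ} (hW : 1 ≤ W) (hA : 1 ≤ A) (hL : 1 ≤ L) :
    roundCost m W A L ≤ 96 * ((Nat.log 2 m + 4) * A * (L * W)) := by
  unfold roundCost
  set g := Nat.log 2 m
  have h1 : L ≤ L * W := Nat.le_mul_of_pos_right _ hW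
  have h2 : (g + 4) * A * L ≤ (g + 4) * A * (L * W) := Nat.mul_le_mul_left _ h1
  have h3 : 4 * L ≤ (g + 4) * A * L := Nat.mul_le_mul_right _ (by nlinarith)
  have h4 : A * L + 2 ≤ 3 * (A * L) := by have := Nat.mul_pos hA hL; omega
  have h5 : 2 * ((2 * g + 3) * (2 * W + 3)) ≤ 2 * ((2 * (g + 4)) * (5 * W)) := by
    gcongr <;> omega
  have h6 := Nat.mul_le_mul h4 h5
  have e1 : 3 * (A * L) * (2 * (2 * (g + 4) * (5 * W))) = 60 * ((g + 4) * A * (L * W)) := by ring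
  have e2 : (g + 4) * (A * (2 * L)) = 2 * ((g + 4) * A * L) := by ring
  omega

/-- The number of samples in the `j`-th round, relative to the scale. -/
def roundWeight (j : ℕ) : ℕ := 4 * (2 * Nat.clog 2 (j + 2) + 3)

/-- Use `exp 1 ≥ 2`: the exponent `2 * c + 3` gives `2 ^ (2 * c + 3) ≥ 8 * (j + 2) ^ 2`. -/
lemma exp_neg_roundWeight_le (j : ℕ) :
    Real.exp (-(roundWeight j / 4 : ℝ)) ≤ 1 / (5 * (j + 1) * (j + 2)) := by
  rw [Real.exp_neg, ← one_div]
  refine one_div_le_one_div_of_le (by positivity) ?_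
  set c := Nat.clog 2 (j + 2) with hc
  have h1 : ((j : ℝ) + 2) ≤ 2 ^ c := by
    exact_mod_cast Nat.le_pow_clog (by norm_num : 1 < 2) (j + 2)
  have h2 : (2 : ℝ) ≤ Real.exp 1 := by have := Real.exp_one_gt_d9; linarith
  have h3 : (roundWeight j / 4 : ℝ) = ((2 * c + 3 : ℕ) : ℝ) * 1 := by
    rw [roundWeight, ← hc]
    push_cast
    ring
  rw [h3, Real.exp_nat_mul]
  calc 5 * ((j : ℝ) + 1) * (j + 2) ≤ 8 * ((j + 2) * (j + 2)) := by
        have : (0 : ℝ) ≤ j := Nat.cast_nonneg _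
        nlinarith
    _ ≤ 8 * (2 ^ c * 2 ^ c) := by gcongr
    _ = 2 ^ (2 * c + 3) := by rw [pow_add, two_mul, pow_add]; ring
    _ ≤ _ := by gcongr

lemma roundWeight_le {t e : ℝ} (ht : 1 ≤ t) (he : 0 < e) (he1 : e ≤ 1) {J : ℕ}
    (hJ : (2 : ℝ) ^ J ≤ 4 * t) :
    (roundWeight J : ℝ) ≤ 104 * Real.log (2 + Real.log (2 + t / e)) := by
  have hte : t ≤ t / e := by rw [le_div_iff₀ he]; nlinarith
  set y := Real.log (2 + t / e) with hy
  have hy0 : 1 / 2 ≤ y := half_le_log (by linarith)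
  have h1 := nat_le_two_mul_log hJ
  have h2 : Real.log (4 * t) ≤ 3 / 2 + y := by
    rw [Real.log_mul (by norm_num) (by linarith), show (4 : ℝ) = 2 ^ 2 by norm_num, Real.log_pow]
    have h3 : Real.log t ≤ y := Real.log_le_log (by linarith) (by linarith)
    have := Real.log_two_lt_d9
    push_cast
    linarith
  -- Since `J + 2 ≤ 5 + 2 * y` is at most a power of `2 + y`, its logarithm is at most a multiple of
  -- `log (2 + y)`.
  have hcube : 8 + 12 * y ≤ (2 + y) ^ 3 := by
    have : (2 + y) ^ 3 = 8 + 12 * y + y ^ 2 * (6 + y) := by ring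
    have : 0 ≤ y ^ 2 * (6 + y) := by positivity
    linarith
  have h3 := clog_le_log (y := J + 2) (z := (2 + y) ^ 3) (by omega) (by push_cast; linarith)
  rw [Real.log_pow] at h3
  have h4 := half_le_log (show 2 ≤ 2 + y by linarith)
  rw [roundWeight]
  push_cast at h3 ⊢
  linarith

lemma roundWeight_mono : Monotone roundWeight := fun i j h => by
  have := Nat.clog_mono_right 2 (show i + 2 ≤ j + 2 by omega)
  unfold roundWeight
  omega

/-- The products `L j * W j` are at most of order `4 ^ j`, so the sum is governed by the last round,
where `4 ^ J ≤ 16 * t ^ 2`. The cubic term of the bound only has to absorb the additive constant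
next to `log n`. -/
lemma sum_roundCost_le {γ t ε e : ℝ} (hγ : 1 ≤ γ) (ht : 1 ≤ t) (hε : 0 < ε) (he : 0 < e)
    (he1 : e ≤ 1) {n m : ℕ} (hm : 0 < m) (hmn : m ≤ n) {W L : ℕ → ℕ} (hW1 : ∀ j, 1 ≤ W j)
    (hL1 : ∀ j, 1 ≤ L j) (hW : ∀ j, (W j : ℝ) ≤ 17 * (γ * 2 ^ j / e))
    (hL : ∀ j, (L j : ℝ) ≤ 178 * W j / ε) {J : ℕ} (hJ : (2 : ℝ) ^ J ≤ 4 * t) :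
    ((∑ j ∈ Finset.Icc 0 J, roundCost m (W j) (roundWeight j) (L j) : ℕ) : ℝ) ≤
      10 ^ 12 * γ ^ 2 * unknownBound n t ε e := by
  set R := (roundWeight J : ℝ) with hR
  set g := (Nat.log 2 m : ℝ) with hg
  have hg0 : 0 ≤ g := Nat.cast_nonneg _
  have hterm : ∀ j ∈ Finset.Icc 0 J, (roundCost m (W j) (roundWeight j) (L j) : ℝ) ≤
      96 * ((g + 4) * R * (178 * 17 ^ 2 / ε * (γ / e) ^ 2)) * 4 ^ j := by
    intro j hj
    have h1 : (roundCost m (W j) (roundWeight j) (L j) : ℝ) ≤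
        96 * ((g + 4) * roundWeight j * (L j * W j)) := by
      rw [hg]
      exact_mod_cast roundCost_le (m := m) (A := roundWeight j) (hW1 j)
        (by unfold roundWeight; omega) (hL1 j)
    have h2 : (roundWeight j : ℝ) ≤ R := by
      rw [hR]
      exact_mod_cast roundWeight_mono (Finset.mem_Icc.1 hj).2
    have h3 : (L j : ℝ) * W j ≤ 178 * 17 ^ 2 / ε * (γ / e) ^ 2 * 4 ^ j := by
      calc (L j : ℝ) * W j ≤ 178 * W j / ε * W j := by gcongr; exact hL j
        _ ≤ 178 * (17 * (γ * 2 ^ j / e)) / ε * (17 * (γ * 2 ^ j / e)) := by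
            gcongr <;> exact hW j
        _ = _ := by
            rw [show (4 : ℝ) = 2 * 2 by norm_num, mul_pow]
            ring
    calc _ ≤ _ := h1
      _ ≤ 96 * ((g + 4) * R * (178 * 17 ^ 2 / ε * (γ / e) ^ 2 * 4 ^ j)) := by gcongr
      _ = _ := by ring
  have hgeom : ∑ j ∈ Finset.Icc 0 J, (4 : ℝ) ^ j ≤ 32 * t ^ 2 := by
    have h1 : ∀ J : ℕ, ∑ j ∈ Finset.range (J + 1), (4 : ℝ) ^ j ≤ 2 * 4 ^ J := by
      intro J
      induction J with
      | zero => simp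
      | succ J ih => 
        have : (0 : ℝ) ≤ 4 ^ J := by positivity
        rw [Finset.sum_range_succ, pow_succ]
        linarith
    have h2 : Finset.Icc 0 J = Finset.range (J + 1) := by
      ext x; simp only [Finset.mem_Icc, Finset.mem_range]; omega
    have h3 : (4 : ℝ) ^ J = 2 ^ J * 2 ^ J := by rw [← mul_pow]; norm_num
    rw [h2]
    have h4 : (2 : ℝ) ^ J * 2 ^ J ≤ (4 * t) * (4 * t) := by gcongr
    have := h1 J
    nlinarith
  have hte : 1 ≤ t / e := by rw [le_div_iff₀ he]; linarith
  have hR' := roundWeight_le ht he he1 hJ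
  set z := Real.log (2 + Real.log (2 + t / e)) with hz
  have hz0 : 0 ≤ z := by
    have : (0 : ℝ) ≤ R := Nat.cast_nonneg _
    linarith
  have hlog : g ≤ 2 * Real.log n := by
    refine nat_le_two_mul_log ?_
    exact_mod_cast (Nat.pow_log_le_self 2 hm.ne').trans hmn
  have hln : 0 ≤ Real.log n := Real.log_natCast_nonneg n
  push_cast
  calc _ ≤ ∑ j ∈ Finset.Icc 0 J,
        96 * ((g + 4) * R * (178 * 17 ^ 2 / ε * (γ / e) ^ 2)) * 4 ^ j := Finset.sum_le_sum hterm
    _ = 96 * ((g + 4) * R * (178 * 17 ^ 2 / ε * (γ / e) ^ 2)) *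
        ∑ j ∈ Finset.Icc 0 J, (4 : ℝ) ^ j := by rw [Finset.mul_sum]
    _ ≤ 96 * ((2 * Real.log n + 4) * (104 * z) * (178 * 17 ^ 2 / ε * (γ / e) ^ 2)) *
        (32 * t ^ 2) := by gcongr
    _ = 96 * 104 * 178 * 17 ^ 2 * 32 * γ ^ 2 * ((t / e) ^ 2 * (2 * Real.log n + 4) * (z / ε)) := by
        ring
    _ ≤ 96 * 104 * 178 * 17 ^ 2 * 32 * γ ^ 2 *
        (4 * ((t / e) ^ 3 + (t / e) ^ 2 * Real.log n) * (z / ε)) := by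
        have h1 : (t / e) ^ 2 * (2 * Real.log n + 4) ≤
            4 * ((t / e) ^ 3 + (t / e) ^ 2 * Real.log n) := by
          have h2 := mul_nonneg (sq_nonneg (t / e)) (sub_nonneg.2 hte)
          have h3 := mul_nonneg (sq_nonneg (t / e)) hln
          linarith [pow_succ (t / e) 2]
        exact mul_le_mul_of_nonneg_left (mul_le_mul_of_nonneg_right h1 (by positivity))
          (by positivity)
    _ = (96 * 104 * 178 * 17 ^ 2 * 32 * 4) * γ ^ 2 * unknownBound n t ε e := by
        rw [unknownBound]; ring
    _ ≤ _ := by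
        have : 0 ≤ unknownBound n t ε e := by unfold unknownBound; positivity
        gcongr
        norm_num

/-! ### The testers -/

lemma exp_neg_two_le : Real.exp (-((8 : ℕ) / 4 : ℝ)) ≤ 1 / 5 := by
  rw [Real.exp_neg, ← one_div]
  refine one_div_le_one_div_of_le (by norm_num) ?_
  rw [show (((8 : ℕ) : ℝ) / 4) = ((2 : ℕ) : ℝ) * 1 by norm_num, Real.exp_nat_mul]
  have := Real.exp_one_gt_d9
  nlinarith

/-- The spacing of the sampled vertices and the radius of the queries. -/
lemma exists_coarsening {α δ e : ℝ} (hα : 0 < α) (hδ : 0 < δ) (he : 0 < e) (he1 : e ≤ 1) :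
    ∃ (s : ℕ) (ρ : ℝ), 0 < s ∧ e * δ ≤ 4 * (s * α) ∧ δ ≤ ρ ∧ ρ ≤ 2 * δ ∧
      δ + 2 * (s - 1) * α ≤ ρ ∧ ρ + 2 * (s - 1) * α ≤ (1 + e) * δ := by
  -- The largest `k` with `4 * k * α ≤ e * δ`: half of the slack is spent on projecting, half on
  -- lifting. If `α` is large then `k = 0`, so all vertices are kept and `ρ = δ`.
  set k := ⌊e * δ / (4 * α)⌋₊ with hk
  have h1 : (k : ℝ) ≤ e * δ / (4 * α) := Nat.floor_le (by positivity)
  have h2 : e * δ / (4 * α) < k + 1 := Nat.lt_floor_add_one _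
  rw [le_div_iff₀ (by positivity)] at h1
  rw [div_lt_iff₀ (by positivity)] at h2
  have h3 : 0 ≤ k * α := by positivity
  have h4 : e * δ ≤ 1 * δ := by gcongr
  refine ⟨k + 1, δ + 2 * k * α, Nat.succ_pos _, ?_, ?_, ?_, ?_, ?_⟩ <;> push_cast <;> linarith

section Testers

variable {X : Type*} [MetricSpace X] {n : ℕ} {P Q : Fin n → X} {α γ δ ε ε' e ρ t : ℝ} {s m : ℕ}

lemma local_sampled (hn : 0 < n) (hα : 0 < α) (hγ : 1 ≤ γ) (he : 0 < e) (ht : 1 ≤ t) (hs : 0 < s)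
    (hsα : e * δ ≤ 4 * (s * α)) (hρ : ρ ≤ 2 * δ) (he1 : e ≤ 1) {W : ℕ} (hW : 16 * γ * t / e ≤ W)
    (hP : EdgeLengthsIn (α / γ) α P) (hQ : EdgeLengthsIn (α / γ) α Q) (hPs : IsStraight t P)
    (hQs : IsStraight t Q) (hm : m = (n - 1) / s + 1) :
    Local (zeroRel (sampled hn s) m (freeSpaceMatrix ρ P Q)) m W := by
  have hγ0 : 0 < γ := by linarith
  have hs' : (0 : ℝ) < s := by exact_mod_cast hs
  refine local_of_isStraight hn (a := α / γ) (by positivity) (by linarith) hP hQ hPs hQs ?_ ?_ hs hm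
  · calc t * (2 * ρ) ≤ t * (4 * δ) := mul_le_mul_of_nonneg_left (by linarith) (by linarith)
      _ = 4 * t / e * (e * δ) := by field_simp
      _ ≤ 4 * t / e * (4 * (s * α)) := by gcongr
      _ = 16 * γ * t / e * (s * (α / γ)) := by field_simp; ring
      _ ≤ _ := by gcongr
  · calc t * α = 1 * (γ * t) * (α / γ) := by field_simp
      _ ≤ 16 / e * (γ * t) * (α / γ) := by
        gcongr
        rw [le_div_iff₀ he]
        linarith
      _ = 16 * γ * t / e * (α / γ) := by ring
      _ ≤ _ := by gcongr

lemma testsCorrectly_of_acc (hn : 0 < n) (hα : 0 < α) (hε : 0 < ε) (hε2 : ε < 2) (hδ : 0 < δ)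
    (hs : 0 < s) (hee : e ≤ ε') (hρ1 : δ + 2 * (s - 1) * α ≤ ρ)
    (hρ2 : ρ + 2 * (s - 1) * α ≤ (1 + e) * δ) {a : ℝ}
    (hP : EdgeLengthsIn a α P) (hQ : EdgeLengthsIn a α Q) (hm : m = (n - 1) / s + 1)
    {A : QueryAlgorithm n}
    (hyes : Consistent m (zeroRel (sampled hn s) m (freeSpaceMatrix ρ P Q)) →
      acc (freeSpaceMatrix ρ P Q) A = 1)
    (hno : (zeroRel (sampled hn s) m (freeSpaceMatrix ρ P Q) 0 0 →
      zeroRel (sampled hn s) m (freeSpaceMatrix ρ P Q) (m - 1) (m - 1) → ∀ k : ℕ,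
      CReach (zeroRel (sampled hn s) m (freeSpaceMatrix ρ P Q)) k (0, 0) (m - 1, m - 1) →
        ε * m < 2 * k) → acc (freeSpaceMatrix ρ P Q) A ≤ 1 / 5) :
    TestsCorrectly (1 + ε') ε δ ρ A P Q := by
  refine ⟨fun h => output_true_eq_one (hyes ?_), fun h => output_false_ge (hno fun h0 h1 k hk => ?_)⟩
  · rw [hm]
    exact consistent_of_discreteFrechetDist_le hn hs hP hQ hα.le hρ1 h
  · refine lt_of_isFar hn hs hε hε2 hP hQ hα.le (hρ2.trans ?_) h hm h0 h1 hk
    gcongr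

end Testers

lemma ceil_le_of_le {x y : ℝ} (hx : 0 ≤ x) (h : x + 1 ≤ y) : (⌈x⌉₊ : ℝ) ≤ y :=
  (Nat.ceil_lt_add_one hx).le.trans h

end FrechetTesting

/-! ### The choice of the parameters. -/

open FrechetTesting

theorem mainTheorem4 (γ : ℝ) (hγ : 1 ≤ γ) :
    ∃ K : ℝ, 0 < K ∧
      ∀ (n : ℕ) (α δ ε ε' : ℝ), 1 ≤ n → 0 < α → 0 < δ → 0 < ε → ε < 2 → 0 < ε' →
        -- `t` is known: the tester may depend on `t`
        (∀ t : ℝ, 1 ≤ t →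
          ∃ (ρ : ℝ) (A : FrechetTesting.QueryAlgorithm n),
            δ ≤ ρ ∧ ρ ≤ (1 + ε') * δ ∧
            ∀ (X : Type*) [MetricSpace X] (P Q : Fin n → X),
              FrechetTesting.EdgeLengthsIn (α / γ) α P →
              FrechetTesting.EdgeLengthsIn (α / γ) α Q →
              FrechetTesting.IsStraight t P → FrechetTesting.IsStraight t Q →
              FrechetTesting.TestsCorrectly (1 + ε') ε δ ρ A P Q ∧
              (A.queryCount (FrechetTesting.freeSpaceMatrix ρ P Q) : ℝ) ≤
                K * FrechetTesting.knownBound t ε (min 1 ε')) ∧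
        -- `t` is unknown: one tester for all `t`
        (∃ (ρ : ℝ) (A : FrechetTesting.QueryAlgorithm n),
          δ ≤ ρ ∧ ρ ≤ (1 + ε') * δ ∧
          ∀ (X : Type*) [MetricSpace X] (P Q : Fin n → X),
            FrechetTesting.EdgeLengthsIn (α / γ) α P →
            FrechetTesting.EdgeLengthsIn (α / γ) α Q →
            ∀ t : ℝ, 1 ≤ t →
              FrechetTesting.IsStraight t P → FrechetTesting.IsStraight t Q →
              FrechetTesting.TestsCorrectly (1 + ε') ε δ ρ A P Q ∧
              (A.queryCount (FrechetTesting.freeSpaceMatrix ρ P Q) : ℝ) ≤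
                K * FrechetTesting.unknownBound n t ε (min 1 ε')) := by
  classical
  set K1 := 52 * (1530 * γ) * (4 * Real.log (2 * (1530 * γ)) + 10) with hK1
  have hγ0 : 0 < γ := by linarith
  have hK1pos : 0 < K1 := by
    have := Real.log_nonneg (show 1 ≤ 2 * (1530 * γ) by linarith)
    positivity
  -- The two parts have separate constants. In `K1`, `1530 = 90 * 17`, where `17` and `90` are `16`
  -- and `88` after rounding up `W` and `L`.
  refine ⟨max K1 (10 ^ 12 * γ ^ 2), lt_max_of_lt_left hK1pos, ?_⟩
  intro n α δ ε ε' hn hα hδ hε hε2 hε'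
  set e := min 1 ε' with he_def
  have he : 0 < e := lt_min one_pos hε'
  have he1 : e ≤ 1 := min_le_left _ _
  have hee : e ≤ ε' := min_le_right _ _
  obtain ⟨s, ρ, hs, hsα, hδρ, hρδ, hρ1, hρ2⟩ := exists_coarsening hα hδ he he1
  have hρε : ρ ≤ (1 + ε') * δ := by
    have h1 : (1 : ℝ) ≤ s := by exact_mod_cast hs
    have h2 : 0 ≤ 2 * (s - 1) * α := mul_nonneg (by linarith) hα.le
    have h3 : (1 + e) * δ ≤ (1 + ε') * δ := by gcongr
    linarith
  obtain ⟨m, hm⟩ : ∃ m, m = (n - 1) / s + 1 := ⟨_, rfl⟩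
  have hm0 : 0 < m := hm ▸ Nat.succ_pos _
  have hmn : m ≤ n := by
    have := Nat.div_le_self (n - 1) s
    omega
  have hsize : ∀ {u : ℝ} {W : ℕ}, 1 ≤ u → (W : ℝ) = ⌈16 * u⌉₊ →
      1 ≤ W ∧ (W : ℝ) ≤ 17 * u := by
    intro u W hu hW
    refine ⟨?_, hW ▸ ceil_le_of_le (by linarith) (by linarith)⟩
    have h1 : 16 * u ≤ W := hW ▸ Nat.le_ceil _
    have h2 : (1 : ℝ) ≤ W := by linarith
    exact_mod_cast h2
  have hWε : ∀ {W : ℕ}, 1 ≤ W → (1 : ℝ) ≤ 2 * W / ε := by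
    intro W hW
    have : (1 : ℝ) ≤ W := by exact_mod_cast hW
    rw [le_div_iff₀ hε]
    linarith
  constructor
  · intro t ht
    have hte : 1 ≤ γ * t / e := by
      rw [le_div_iff₀ he]
      nlinarith
    set W := ⌈16 * (γ * t / e)⌉₊ with hW
    obtain ⟨hW1, hW17⟩ := hsize hte (congrArg Nat.cast hW)
    set L := ⌈88 * W / ε⌉₊ with hL
    have hWL : 88 * (W : ℝ) ≤ ε * L := by
      rw [mul_comm ε, ← div_le_iff₀ hε]
      exact Nat.le_ceil _
    have hL0 : 0 < L := Nat.ceil_pos.2 (by positivity)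
    have hLle : (L : ℝ) ≤ 1530 * γ * (t / (ε * e)) := by
      have h1 := hWε hW1
      have h2 : (L : ℝ) ≤ 90 * W / ε := ceil_le_of_le (by positivity) (by
        rw [show 90 * (W : ℝ) / ε = 88 * W / ε + 2 * W / ε by ring]
        linarith)
      calc (L : ℝ) ≤ 90 * W / ε := h2
        _ ≤ 90 * (17 * (γ * t / e)) / ε := by gcongr
        _ = _ := by field_simp; ring
    refine ⟨ρ, knownTester (sampled hn s) m 8 L, hδρ, hρε, ?_⟩
    intro X _ P Q hP hQ hPs hQs
    have hloc := local_sampled hn hα hγ he ht hs hsα hρδ he1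
      (le_trans (le_of_eq (by ring)) (Nat.le_ceil (16 * (γ * t / e)))) hP hQ hPs hQs hm
    refine ⟨testsCorrectly_of_acc hn hα hε hε2 hδ hs hee hρ1 hρ2 hP hQ hm
      (fun hc => acc_knownTester_eq_one hm0 hc _ _)
      fun hfar => (acc_knownTester_le hm0 hε hloc hWL hfar).trans exp_neg_two_le, ?_⟩
    have h1 := queryCount_knownTester_le (M := freeSpaceMatrix ρ P Q) (ι := sampled hn s) (A := 8)
      hm0 hL0
    have h2 := knownCost_le hγ ht hε hε2 he he1 hL0 hLle
    have h3 : 0 ≤ knownBound t ε e := by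
      unfold knownBound
      have h4 : 0 ≤ t / (ε * e) := by positivity
      exact mul_nonneg h4 (Real.log_nonneg (by linarith))
    calc _ ≤ _ := Nat.cast_le.2 h1
      _ ≤ K1 * knownBound t ε e := h2
      _ ≤ _ := by gcongr; exact le_max_left _ _
  · have hu : ∀ j : ℕ, 1 ≤ γ * 2 ^ j / e := fun j => by
      rw [le_div_iff₀ he]
      have : (1 : ℝ) ≤ 2 ^ j := one_le_pow₀ (by norm_num)
      nlinarith
    set W : ℕ → ℕ := fun j => ⌈16 * (γ * 2 ^ j / e)⌉₊ with hW
    have hW1 : ∀ j, 1 ≤ W j := fun j => (hsize (W := W j) (hu j) rfl).1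
    have hW17 : ∀ j, (W j : ℝ) ≤ 17 * (γ * 2 ^ j / e) := fun j => (hsize (W := W j) (hu j) rfl).2
    set L : ℕ → ℕ := fun j => ⌈176 * W j / ε⌉₊ with hL
    have hWL : ∀ j, 176 * (W j : ℝ) ≤ ε * L j := fun j => by
      rw [mul_comm ε, ← div_le_iff₀ hε]
      exact Nat.le_ceil _
    have hLle : ∀ j, (L j : ℝ) ≤ 178 * W j / ε := fun j => by
      have h1 := hWε (hW1 j)
      refine ceil_le_of_le (by positivity) ?_
      rw [show 178 * (W j : ℝ) / ε = 176 * W j / ε + 2 * W j / ε by ring]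
      linarith
    have hLj : ∀ j, 2 ^ j ≤ L j := fun j => by
      have h1 : (2 : ℝ) ^ j ≤ γ * 2 ^ j / e := by
        rw [le_div_iff₀ he]
        have h2 : (2 : ℝ) ^ j * e ≤ 2 ^ j * γ := by gcongr; linarith
        linarith
      have h2 : 16 * (γ * 2 ^ j / e) ≤ W j := Nat.le_ceil _
      have h3 := hWL j
      have h4 : ε * L j ≤ 2 * L j := by gcongr
      have h5 : (2 : ℝ) ^ j ≤ L j := by
        have : (0 : ℝ) < 2 ^ j := by positivity
        linarith
      exact_mod_cast h5
    refine ⟨ρ, unknownTester (sampled hn s) m W roundWeight L m 0, hδρ, hρε, ?_⟩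
    intro X _ P Q hP hQ t ht hPs hQs
    refine ⟨testsCorrectly_of_acc hn hα hε hε2 hδ hs hee hρ1 hρ2 hP hQ hm
      (fun hc => acc_unknownTester_eq_one hm0 hc _ _ _ _ _) fun hfar => ?_, ?_⟩
    · refine (acc_unknownTester_le hm0 hε hWL exp_neg_roundWeight_le hfar m 0).trans ?_
      norm_num
    -- The first guess with `2 ^ J ≥ t`; rounding overshoots `t` by a factor of at most `4`.
    · set J := Nat.clog 2 ⌈t⌉₊ with hJ
      have ht1 : 1 ≤ ⌈t⌉₊ := Nat.ceil_pos.2 (by linarith)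
      have htJ : t ≤ 2 ^ J := (Nat.le_ceil t).trans (by
        exact_mod_cast Nat.le_pow_clog (by norm_num) ⌈t⌉₊)
      have hJt : (2 : ℝ) ^ J ≤ 4 * t := by
        have h1 : ((2 ^ J : ℕ) : ℝ) ≤ ((2 * ⌈t⌉₊ : ℕ) : ℝ) := Nat.cast_le.2 (two_pow_clog_le ht1)
        have h2 := Nat.ceil_lt_add_one (show 0 ≤ t by linarith)
        push_cast at h1
        linarith
      have hloc := local_sampled hn hα hγ he ht hs hsα hρδ he1 (W := W J)
        (le_trans (by
          rw [show 16 * γ * t / e = 16 * (γ * t / e) by ring]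
          gcongr) (Nat.le_ceil (16 * (γ * 2 ^ J / e)))) hP hQ hPs hQs hm
      have h1 := queryCount_unknownTester_le (A := roundWeight) hm0
        (fun j => (Nat.two_pow_pos j).trans_le (hLj j))
        (fun j => Nat.lt_two_pow_self.le.trans (hLj j)) hloc m 0 (Nat.zero_le _) le_rfl
      have h2 := sum_roundCost_le hγ ht hε he he1 hm0 hmn hW1
        (fun j => Nat.one_le_two_pow.trans (hLj j)) hW17 hLle hJt
      have h3 : 0 ≤ unknownBound n t ε e := by
        have h4 : 0 ≤ t / e := by positivity
        have h5 : 0 ≤ Real.log (2 + t / e) := Real.log_nonneg (by linarith)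
        have h6 : 0 ≤ Real.log (2 + Real.log (2 + t / e)) := Real.log_nonneg (by linarith)
        have h7 := Real.log_natCast_nonneg n
        unfold unknownBound
        positivity
      calc _ ≤ _ := Nat.cast_le.2 h1
        _ ≤ 10 ^ 12 * γ ^ 2 * unknownBound n t ε e := h2
        _ ≤ _ := by gcongr; exact le_max_right _ _
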